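/- Let $0<r_i<r_e$, $\rho=r_i/r_e$, $\Gamma_i=\{x\in\mathbb R^3:|x|=r_i\}$, $\Gamma_e=\{x\in\mathbb R^3:|x|=r_e\}$, with outward unit normals $\nu_i,\nu_e$, and let $G(x)=-\frac{1}{4\pi|x|}$. For a sphere $\Gamma$ centred at $0$ with surface measure $\sigma$ and outward unit normal $\nu$ put $$\mathcal S_\Gamma[\varphi](x)=\int_\Gamma G(x-y)\varphi(y)\,d\sigma(y),\qquad \mathcal K_\Gamma^*[\varphi](x)=\int_\Gamma\frac{\partial G(x-y)}{\partial\nu(x)}\varphi(y)\,d\sigma(y).$$ For $n\ge 0$ let $Y_n^m$, $m=-n,\dots,n$, denote orthonormal (complex) spherical harmonics of degree $n$, i.e. restrictions to the unit sphere of harmonic homogeneous polynomials of degree $n$ that are orthonormal in $L^2$ of the unit sphere, regarded as functions $x\mapsto Y_n^m(\hat x)$, $\hat x=x/|x|$. (a) If $\Gamma=\{|x|=r_0\}$, $r_0>0$, then $\mathcal K_\Gamma^*[Y_n^m](x)=\frac{1}{2(2n+1)}Y_n^m(\hat x)$ for all $|x|=r_0$, $n\ge0$, $m=-n,\dots,n$.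 (b) The formula $$\mathbb K^*\begin{bmatrix}\varphi_i\\ \varphi_e\end{bmatrix}=\begin{bmatrix}-\mathcal K_{\Gamma_i}^*[\varphi_i]-\frac{\partial}{\partial\nu_i}\mathcal S_{\Gamma_e}[\varphi_e]\\[2pt] \frac{\partial}{\partial\nu_e}\mathcal S_{\Gamma_i}[\varphi_i]+\mathcal K_{\Gamma_e}^*[\varphi_e]\end{bmatrix}$$ defines a bounded linear operator on the complex space $\mathcal H=L^2(\Gamma_i)\times L^2(\Gamma_e)$, and its eigenvalues are exactly the numbers $$\pm\lambda_n,\qquad \lambda_n=\frac{1}{2(2n+1)}\sqrt{1+4n(n+1)\rho^{2n+1}},\qquad n=0,1,\dots.$$ (c) For every $n$, corresponding eigenfunctions for $+\lambda_n$ and $-\lambda_n$ are, respectively, $$\begin{bmatrix}\bigl(\sqrt{1+4n(n+1)\rho^{2n+1}}-1\bigr)Y_n^m\\ 2(n+1)\rho^{n+2}Y_n^m\end{bmatrix},\qquad \begin{bmatrix}\bigl(-\sqrt{1+4n(n+1)\rho^{2n+1}}-1\bigr)Y_n^m\\ 2(n+1)\rho^{n+2}Y_n^m\end{bmatrix},\qquad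 m=-n,\dots,n,$$ and they span the eigenspaces of $+\lambda_n$ and $-\lambda_n$. -/

import Mathlib

open MeasureTheory Module.End

noncomputable section

/-- Euclidean three-space. -/
abbrev E3 : Type := EuclideanSpace ℝ (Fin 3)

/-- Surface measure `σ` of the sphere `{|x| = r}`, as a measure on `ℝ³`: the surface measure of
the unit sphere, transported by `ω ↦ r ω` and multiplied by `r ^ 2`. -/
def surfaceMeasure (r : ℝ) : Measure E3 :=
  ENNReal.ofReal (r ^ 2) •
    ((volume : Measure E3).toSphere.map fun ω : Metric.sphere (0 : E3) 1 => r • (ω : E3))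

/-- The fundamental solution `-1 / (4 π |x|)` of the Laplacian in `ℝ³`. -/
def fundSol (x : E3) : ℝ := -(1 / (4 * Real.pi * ‖x‖))

/-- The unit vector `x̂ = x / |x|`; on a sphere centred at `0` it is the outward unit normal. -/
def unitVec (x : E3) : E3 := ‖x‖⁻¹ • x

/-- The single layer potential of the density `φ` on the sphere `{|x| = r}`. -/
def singleLayer (r : ℝ) (φ : E3 → ℂ) (x : E3) : ℂ :=
  ∫ y, fundSol (x - y) • φ y ∂(surfaceMeasure r)

/-- The normal derivative, along the centred sphere through `x`, of a function `u` on `ℝ³`. -/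
def normalDeriv (u : E3 → ℂ) (x : E3) : ℂ := fderiv ℝ u x (unitVec x)

/-- The Neumann–Poincaré operator `𝒦*` of the sphere `{|x| = r}`: the integral operator whose
kernel is the derivative of `G (x - y)` in the direction of the normal at `x`. -/
def neumannPoincareStar (r : ℝ) (φ : E3 → ℂ) (x : E3) : ℂ :=
  ∫ y, fderiv ℝ fundSol (x - y) (unitVec x) • φ y ∂(surfaceMeasure r)

/-- `ℋ = L²(Γᵢ) × L²(Γₑ)`, complex valued. -/
abbrev DensitySpace (ri re : ℝ) : Type :=
  Lp ℂ 2 (surfaceMeasure ri) × Lp ℂ 2 (surfaceMeasure re)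

/-- `T` is the Neumann–Poincaré-type operator `𝕂*` of the spheres of radii `ri` and `re`, that is,
`T (φᵢ, φₑ) = (-𝒦*ᵢ φᵢ - ∂_{νᵢ} 𝒮ₑ φₑ, ∂_{νₑ} 𝒮ᵢ φᵢ + 𝒦*ₑ φₑ)` for every `(φᵢ, φₑ)` in `ℋ`.
There is at most one such `T`. -/
def IsNPOperator (ri re : ℝ) (T : DensitySpace ri re →L[ℂ] DensitySpace ri re) : Prop :=
  ∀ φ : DensitySpace ri re,
    ((T φ).1 =ᵐ[surfaceMeasure ri] fun x =>
      -neumannPoincareStar ri φ.1 x - normalDeriv (singleLayer re φ.2) x) ∧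
    ((T φ).2 =ᵐ[surfaceMeasure re] fun x =>
      normalDeriv (singleLayer ri φ.1) x + neumannPoincareStar re φ.2 x)

/-- The function `x ↦ p(x̂)` given by a polynomial `p` in three variables. -/
def angular (p : MvPolynomial (Fin 3) ℂ) (x : E3) : ℂ :=
  MvPolynomial.eval (fun i => ((unitVec x i : ℝ) : ℂ)) p

/-- The family `x ↦ angular (Y m) x`, `m = -n, …, n`, is an orthonormal family of spherical
harmonics of degree `n`: the `Y m` are harmonic homogeneous polynomials of degree `n` (so that
`Y m` is the solid harmonic `|x|ⁿ Yₙᵐ(x̂)`), orthonormal in `L²` of the unit sphere. -/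
structure IsOrthonormalSphericalHarmonics (n : ℕ)
    (Y : Set.Icc (-(n : ℤ)) n → MvPolynomial (Fin 3) ℂ) : Prop where
  homogeneous : ∀ m, (Y m).IsHomogeneous n
  harmonic : ∀ m, ∑ i, MvPolynomial.pderiv i (MvPolynomial.pderiv i (Y m)) = 0
  orthonormal : ∀ m m', ∫ x, angular (Y m) x * starRingEnd ℂ (angular (Y m') x)
    ∂(surfaceMeasure 1) = if m = m' then 1 else 0

instance surfaceMeasure_isFinite (r : ℝ) : IsFiniteMeasure (surfaceMeasure r) := by
  unfold surfaceMeasure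
  exact Measure.smul_finite _ ENNReal.ofReal_ne_top

theorem measurable_unitVec : Measurable unitVec := by
  unfold unitVec
  fun_prop

theorem norm_unitVec_le (x : E3) : ‖unitVec x‖ ≤ 1 := by
  unfold unitVec
  rw [norm_smul, norm_inv, norm_norm]
  exact inv_mul_le_one

theorem memLp_angular (r : ℝ) (p : MvPolynomial (Fin 3) ℂ) :
    MemLp (angular p) 2 (surfaceMeasure r) := by
  have hc : Continuous fun x : E3 => MvPolynomial.eval (fun i => ((x i : ℝ) : ℂ)) p :=
    p.continuous_eval.comp (by fun_prop)
  obtain ⟨C, hC⟩ := (isCompact_closedBall (0 : E3) 1).exists_bound_of_continuousOn hc.continuousOn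
  refine MemLp.of_bound (hc.measurable.comp measurable_unitVec).aestronglyMeasurable C
    (Filter.Eventually.of_forall fun x => hC (unitVec x) ?_)
  simpa using norm_unitVec_le x

/-- `x ↦ p(x̂)` as an element of `L²` of the sphere of radius `r`. -/
def angularLp (r : ℝ) (p : MvPolynomial (Fin 3) ℂ) : Lp ℂ 2 (surfaceMeasure r) :=
  (memLp_angular r p).toLp (angular p)

/-- `√(1 + 4 n (n + 1) ρ ^ (2 n + 1))` -/
def npRoot (ρ : ℝ) (n : ℕ) : ℝ := √(1 + 4 * n * (n + 1) * ρ ^ (2 * n + 1))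

/-- `√(1 + 4 n (n + 1) ρ ^ (2 n + 1)) / (2 (2 n + 1))` -/
def npEigenvalue (ρ : ℝ) (n : ℕ) : ℝ := 1 / (2 * (2 * n + 1)) * npRoot ρ n

/-- The pair `((s - 1) Yₙᵐ, 2 (n + 1) ρ ^ (n + 2) Yₙᵐ)`, with `ρ = ri / re`, in `ℋ`. -/
def npPair (ri re : ℝ) (n : ℕ) (s : ℝ) (p : MvPolynomial (Fin 3) ℂ) : DensitySpace ri re :=
  (((s - 1 : ℝ) : ℂ) • angularLp ri p,
    ((2 * (n + 1) * (ri / re) ^ (n + 2) : ℝ) : ℂ) • angularLp re p)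

end

/-
The surface measure is invariant under rotations, so infinitesimal rotations are skew, and the
spherical Laplacian, half the sum of their squares, is symmetric and can be moved from a zonal
kernel onto the density. Harmonicity of `1 / |x|` therefore makes the potential `u(s)` at `s ξ` of a
spherical harmonic `Y` of degree `n` solve `s² u'' + 2 s u' = n (n + 1) u`, whence `u = c s ^ n` for
`s < 1`. As `2 s u' + u` is `4 π` times the Poisson integral of `Y`, letting `s → 1` gives
`(2 n + 1) c = 4 π Y ξ`; inversion settles `s > 1` and Fatou and dominated convergence `s = 1`.

On a single sphere the kernel of `𝒦*` is a constant multiple of `1 / |x - y|`, which gives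
`1 / (2 (2 n + 1))` in (a). Across the two spheres only the powers of `s` enter, so `𝕂*` acts on
pairs of harmonics of degree `n` by a `2 × 2` matrix whose square is the scalar `λ_n²`. Integrating
an eigenvector for `z` against harmonics of degree `n` gives an eigenvector of that matrix, or `0`,
and always `0` unless `z² = λ_n²`. Since `λ_n²` is strictly decreasing in `n` and polynomials, hence
harmonics, are dense in `L²` of the sphere, only one degree survives, and the eigenspaces are as
claimed.
-/

noncomputable section

open MvPolynomial Filter Topology Metric
open scoped Pointwise

section UnitSphere

/-- The unit sphere of `V`. -/
abbrev UnitSphere (V : Type*) [NormedAddCommGroup V] : Type _ := sphere (0 : V) 1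

theorem UnitSphere.norm_coe {V : Type*} [NormedAddCommGroup V] (ω : UnitSphere V) :
    ‖(ω : V)‖ = 1 := by simp

variable {V : Type*} [NormedAddCommGroup V] [InnerProductSpace ℝ V]

theorem UnitSphere.inner_mem_Icc (ξ ω : UnitSphere V) : inner ℝ (ξ : V) ω ∈ Set.Icc (-1 : ℝ) 1 := by
  simpa [abs_le] using abs_real_inner_le_norm (ξ : V) ω

/-- The action of a linear isometry on the unit sphere. -/
def sphereMap (R : V ≃ₗᵢ[ℝ] V) (ω : UnitSphere V) : UnitSphere V :=
  ⟨R ω, by simp [R.norm_map]⟩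

theorem continuous_sphereMap (R : V ≃ₗᵢ[ℝ] V) : Continuous (sphereMap R) := by
  unfold sphereMap
  fun_prop

variable [FiniteDimensional ℝ V] [MeasurableSpace V] [BorelSpace V]

/-- The surface measure of the unit sphere of `V`, as a measure on the unit sphere. -/
abbrev sphereMeasure (V : Type*) [NormedAddCommGroup V] [InnerProductSpace ℝ V]
    [FiniteDimensional ℝ V] [MeasurableSpace V] [BorelSpace V] : Measure (UnitSphere V) :=
  (volume : Measure V).toSphere

theorem integrable_sphereMeasure {F : Type*} [NormedAddCommGroup F] {g : UnitSphere V → F}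
    (hg : Continuous g) : Integrable g (sphereMeasure V) :=
  hg.integrable_of_hasCompactSupport (.of_compactSpace g)

theorem measurePreserving_sphereMap (R : V ≃ₗᵢ[ℝ] V) :
    MeasurePreserving (sphereMap R) (sphereMeasure V) (sphereMeasure V) := by
  refine ⟨(continuous_sphereMap R).measurable, Measure.ext fun s hs => ?_⟩
  have hs' := (continuous_sphereMap R).measurable hs
  have himage : R ⁻¹' (Set.Ioo (0 : ℝ) 1 • (((↑) : UnitSphere V → V) '' s))
      = Set.Ioo (0 : ℝ) 1 • (((↑) : UnitSphere V → V) '' (sphereMap R ⁻¹' s)) := by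
    ext x
    constructor
    · rintro ⟨r, hr, -, ⟨y, hy, rfl⟩, h : r • (y : V) = R x⟩
      refine ⟨r, hr, _, ⟨sphereMap R.symm y, by simpa [sphereMap] using hy, rfl⟩, ?_⟩
      simp [sphereMap, ← map_smul, h]
    · rintro ⟨r, hr, -, ⟨y, hy, rfl⟩, rfl⟩
      exact ⟨r, hr, _, ⟨sphereMap R y, hy, rfl⟩, by simp [sphereMap]⟩
  rw [Measure.map_apply (continuous_sphereMap R).measurable hs, Measure.toSphere_apply' _ hs,
    Measure.toSphere_apply' _ hs', ← himage,
    R.measurePreserving.measure_preimage_emb R.toHomeomorph.measurableEmbedding]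

theorem integral_sphereMap {F : Type*} [NormedAddCommGroup F] [NormedSpace ℝ F]
    (R : V ≃ₗᵢ[ℝ] V) (g : UnitSphere V → F) :
    ∫ ω, g (sphereMap R ω) ∂sphereMeasure V = ∫ ω, g ω ∂sphereMeasure V := by
  have hemb : MeasurableEmbedding (sphereMap R) := by
    refine (continuous_sphereMap R).measurableEmbedding fun a b h => ?_
    exact Subtype.ext (R.injective (congrArg Subtype.val h))
  exact (measurePreserving_sphereMap R).integral_comp hemb g

/-- The cone over a point lies in a line, which is a null set. -/
theorem sphereMeasure_singleton (hV : 1 < Module.finrank ℝ V) (ξ : UnitSphere V) :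
    sphereMeasure V {ξ} = 0 := by
  rw [Measure.toSphere_apply' _ (measurableSet_singleton ξ), Set.image_singleton]
  have hline : ℝ ∙ (ξ : V) ≠ ⊤ := fun h => by
    have h1 := finrank_span_singleton (K := ℝ) (ne_zero_of_mem_unit_sphere ξ)
    rw [h, finrank_top] at h1
    omega
  have hcone : Set.Ioo (0 : ℝ) 1 • {(ξ : V)} ⊆ ((ℝ ∙ (ξ : V) : Submodule ℝ V) : Set V) := by
    rintro - ⟨r, -, -, rfl, rfl⟩
    exact Submodule.smul_mem _ r (Submodule.mem_span_singleton_self _)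
  rw [measure_mono_null hcone (Measure.addHaar_submodule volume _ hline), mul_zero]

theorem ae_inner_lt_one (hV : 1 < Module.finrank ℝ V) (ξ : UnitSphere V) :
    ∀ᵐ ω : UnitSphere V ∂sphereMeasure V, inner ℝ (ξ : V) ω < 1 := by
  filter_upwards [measure_eq_zero_iff_ae_notMem.1 (sphereMeasure_singleton hV ξ)] with ω hω
  refine lt_of_le_of_ne (ξ.inner_mem_Icc ω).2 fun h => hω (Subtype.ext ?_)
  exact ((inner_eq_one_iff_of_norm_eq_one ξ.norm_coe ω.norm_coe).1 h).symm

end UnitSphere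

theorem sphereMeasure_real_univ : (sphereMeasure E3).real Set.univ = 4 * Real.pi := by
  rw [Measure.toSphere_real_apply_univ, measureReal_def, EuclideanSpace.volume_ball_fin_three]
  simp only [ENNReal.ofReal_one, one_pow, one_mul, finrank_euclideanSpace_fin,
    ENNReal.toReal_ofReal (by positivity : 0 ≤ Real.pi * 4 / 3)]
  norm_num
  ring

theorem hasDerivAt_integral_of_continuousOn {X F : Type*} [TopologicalSpace X] [CompactSpace X]
    [MeasurableSpace X] [OpensMeasurableSpace X] (μ : Measure X) [IsFiniteMeasure μ]
    [NormedAddCommGroup F] [NormedSpace ℝ F] {U : Set ℝ} (hU : IsOpen U) {f f' : ℝ → X → F}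
    (hf : ContinuousOn (fun z : ℝ × X => f z.1 z.2) (U ×ˢ Set.univ))
    (hf' : ContinuousOn (fun z : ℝ × X => f' z.1 z.2) (U ×ˢ Set.univ))
    (hderiv : ∀ s ∈ U, ∀ x, HasDerivAt (fun s => f s x) (f' s x) s) {s : ℝ} (hs : s ∈ U) :
    HasDerivAt (fun s => ∫ x, f s x ∂μ) (∫ x, f' s x ∂μ) s := by
  have hint : ∀ {g : ℝ → X → F}, ContinuousOn (fun z : ℝ × X => g z.1 z.2) (U ×ˢ Set.univ) →
      ∀ u ∈ U, Integrable (g u) μ := fun hg u hu =>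
    (hg.comp_continuous (f := fun x => (u, x)) (by fun_prop) fun x => ⟨hu, trivial⟩
      ).integrable_of_hasCompactSupport (.of_compactSpace _)
  obtain ⟨ε, hε, hball⟩ := nhds_basis_closedBall.mem_iff.1 (hU.mem_nhds hs)
  obtain ⟨C, hC⟩ := ((isCompact_closedBall s ε).prod (isCompact_univ (X := X))
    ).exists_bound_of_continuousOn (hf'.mono (Set.prod_mono hball subset_rfl))
  refine (hasDerivAt_integral_of_dominated_loc_of_deriv_le (bound := fun _ => C)
    (closedBall_mem_nhds s hε) ?_ (hint hf s hs) (hint hf' s hs).aestronglyMeasurable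
    ?_ (integrable_const C) ?_).2
  · filter_upwards [hU.mem_nhds hs] with u hu using (hint hf u hu).aestronglyMeasurable
  · exact .of_forall fun x u hu => hC (u, x) ⟨hu, trivial⟩
  · exact .of_forall fun x u hu => hderiv u (hball hu) x

section Rotations

variable {V : Type*} [NormedAddCommGroup V] [InnerProductSpace ℝ V] [FiniteDimensional ℝ V]

/-- The one-parameter group of rotations generated by the skew-adjoint operator `A`. -/
def rotFlow (A : skewAdjoint (V →L[ℝ] V)) (θ : ℝ) : V ≃ₗᵢ[ℝ] V :=
  let _ : NormedAlgebra ℚ (V →L[ℝ] V) := .restrictScalars ℚ ℝ _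
  Unitary.linearIsometryEquiv ⟨NormedSpace.exp (θ • (A : V →L[ℝ] V)),
    NormedSpace.exp_mem_unitary_of_mem_skewAdjoint (θ • A).2⟩

variable {A : skewAdjoint (V →L[ℝ] V)}

theorem rotFlow_apply (A : skewAdjoint (V →L[ℝ] V)) (θ : ℝ) (v : V) :
    rotFlow A θ v = NormedSpace.exp (θ • (A : V →L[ℝ] V)) v := rfl

theorem rotFlow_zero_apply (A : skewAdjoint (V →L[ℝ] V)) (v : V) : rotFlow A 0 v = v := by
  let _ : NormedAlgebra ℚ (V →L[ℝ] V) := .restrictScalars ℚ ℝ _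
  simp [rotFlow_apply]

theorem sphereMap_rotFlow_zero (A : skewAdjoint (V →L[ℝ] V)) (ω : UnitSphere V) :
    sphereMap (rotFlow A 0) ω = ω :=
  Subtype.ext (rotFlow_zero_apply A ω)

theorem rotFlow_add_apply (A : skewAdjoint (V →L[ℝ] V)) (θ τ : ℝ) (v : V) :
    rotFlow A (θ + τ) v = rotFlow A θ (rotFlow A τ v) := by
  let _ : NormedAlgebra ℚ (V →L[ℝ] V) := .restrictScalars ℚ ℝ _
  simp only [rotFlow_apply, add_smul, NormedSpace.exp_add_of_commute
    (((Commute.refl (A : V →L[ℝ] V)).smul_left θ).smul_right τ), mul_apply_eq_comp]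

theorem hasDerivAt_rotFlow (A : skewAdjoint (V →L[ℝ] V)) (θ : ℝ) (v : V) :
    HasDerivAt (fun θ => rotFlow A θ v) ((A : V →L[ℝ] V) (rotFlow A θ v)) θ := by
  simpa [rotFlow_apply] using
    (hasDerivAt_exp_smul_const' (A : V →L[ℝ] V) θ).clm_apply (hasDerivAt_const θ v)

theorem continuous_rotFlow (A : skewAdjoint (V →L[ℝ] V)) :
    Continuous fun z : ℝ × UnitSphere V => sphereMap (rotFlow A z.1) z.2 := by
  have hexp : Continuous fun θ : ℝ => NormedSpace.exp (θ • (A : V →L[ℝ] V)) :=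
    continuous_iff_continuousAt.2 fun θ =>
      (hasDerivAt_exp_smul_const' (A : V →L[ℝ] V) θ).continuousAt
  exact ((hexp.comp continuous_fst).clm_apply
    (continuous_subtype_val.comp continuous_snd)).subtype_mk _

variable {F : Type*} [NormedAddCommGroup F] [NormedSpace ℝ F]

/-- The continuous function `f` on the unit sphere has the continuous derivative `f'` along the
rotations generated by `A`. -/
structure HasRotDeriv (A : skewAdjoint (V →L[ℝ] V)) (f f' : UnitSphere V → F) : Prop where
  continuous : Continuous f
  continuous_deriv : Continuous f'
  hasDerivAt_zero : ∀ ω, HasDerivAt (fun θ => f (sphereMap (rotFlow A θ) ω)) (f' ω) 0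

namespace HasRotDeriv

theorem hasDerivAt {f f' : UnitSphere V → F} (h : HasRotDeriv A f f') (ω : UnitSphere V) (θ : ℝ) :
    HasDerivAt (fun θ => f (sphereMap (rotFlow A θ) ω)) (f' (sphereMap (rotFlow A θ) ω)) θ := by
  have hflow : ∀ τ, sphereMap (rotFlow A τ) ω
      = sphereMap (rotFlow A (τ - θ)) (sphereMap (rotFlow A θ) ω) := fun τ => by
    refine Subtype.ext ?_
    change rotFlow A τ ω = rotFlow A (τ - θ) (rotFlow A θ ω)
    rw [← rotFlow_add_apply, sub_add_cancel]
  have h0 := h.hasDerivAt_zero (sphereMap (rotFlow A θ) ω)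
  rw [← sub_self θ] at h0
  exact (h0.comp_sub_const θ θ).congr_of_eventuallyEq
    (.of_forall fun τ => congrArg f (hflow τ))

theorem add {f f' g g' : UnitSphere V → F} (hf : HasRotDeriv A f f') (hg : HasRotDeriv A g g') :
    HasRotDeriv A (f + g) (f' + g') :=
  ⟨hf.1.add hg.1, hf.2.add hg.2, fun ω => (hf.3 ω).add (hg.3 ω)⟩

theorem mul {R : Type*} [NormedRing R] [NormedAlgebra ℝ R] {f f' g g' : UnitSphere V → R}
    (hf : HasRotDeriv A f f') (hg : HasRotDeriv A g g') :
    HasRotDeriv A (f * g) (f' * g + f * g') := by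
  refine ⟨hf.1.mul hg.1, (hf.2.mul hg.1).add (hf.1.mul hg.2), fun ω => ?_⟩
  have h := (hf.3 ω).mul (hg.3 ω)
  rwa [sphereMap_rotFlow_zero] at h

theorem ofReal {f f' : UnitSphere V → ℝ} (hf : HasRotDeriv A f f') :
    HasRotDeriv A (fun ω => (f ω : ℂ)) fun ω => (f' ω : ℂ) :=
  ⟨Complex.continuous_ofReal.comp hf.1, Complex.continuous_ofReal.comp hf.2,
    fun ω => (hf.3 ω).ofReal_comp⟩

theorem inner_right (A : skewAdjoint (V →L[ℝ] V)) (v : V) :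
    HasRotDeriv A (fun ω => inner ℝ v ω) fun ω => inner ℝ v ((A : V →L[ℝ] V) ω) := by
  refine ⟨by fun_prop, by fun_prop, fun ω => ?_⟩
  have h := (innerSL ℝ v).hasFDerivAt.comp_hasDerivAt 0 (hasDerivAt_rotFlow A 0 ω)
  rwa [rotFlow_zero_apply] at h

theorem comp_inner {G G' : ℝ → ℝ} (hG : ∀ t ∈ Set.Icc (-1 : ℝ) 1, HasDerivAt G (G' t) t)
    (hG' : ContinuousOn G' (Set.Icc (-1) 1)) (ξ : UnitSphere V) :
    HasRotDeriv A (fun ω => G (inner ℝ (ξ : V) ω))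
      fun ω => G' (inner ℝ (ξ : V) ω) * inner ℝ (ξ : V) ((A : V →L[ℝ] V) ω) := by
  have hinner : Continuous fun ω : UnitSphere V => inner ℝ (ξ : V) (ω : V) := by fun_prop
  have hGc : ContinuousOn G (Set.Icc (-1) 1) := fun t ht =>
    (hG t ht).continuousAt.continuousWithinAt
  refine ⟨hGc.comp_continuous hinner ξ.inner_mem_Icc,
    (hG'.comp_continuous hinner ξ.inner_mem_Icc).mul (by fun_prop), fun ω => ?_⟩
  refine HasDerivAt.comp (h₂ := G) 0 ?_ ((inner_right A (ξ : V)).3 ω)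
  simpa only [sphereMap_rotFlow_zero] using hG _ (ξ.inner_mem_Icc ω)

variable [MeasurableSpace V] [BorelSpace V]

theorem integral_deriv_eq_zero {f f' : UnitSphere V → F} (h : HasRotDeriv A f f') :
    ∫ ω, f' ω ∂sphereMeasure V = 0 := by
  have hderiv := hasDerivAt_integral_of_continuousOn (sphereMeasure V) isOpen_univ
    (h.1.comp (continuous_rotFlow A)).continuousOn (h.2.comp (continuous_rotFlow A)).continuousOn
    (fun θ _ ω => h.hasDerivAt ω θ) (Set.mem_univ 0)
  simp only [integral_sphereMap] at hderiv
  exact hderiv.unique (hasDerivAt_const _ _)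

theorem integral_deriv_mul {R : Type*} [NormedRing R] [NormedAlgebra ℝ R]
    {f f' g g' : UnitSphere V → R} (hf : HasRotDeriv A f f') (hg : HasRotDeriv A g g') :
    ∫ ω, f' ω * g ω ∂sphereMeasure V = -∫ ω, f ω * g' ω ∂sphereMeasure V := by
  rw [eq_neg_iff_add_eq_zero, ← (hf.mul hg).integral_deriv_eq_zero]
  exact (integral_add (integrable_sphereMeasure (hf.2.mul hg.1))
    (integrable_sphereMeasure (hf.1.mul hg.2))).symm

end HasRotDeriv

end Rotations

section PolynomialLaplacian

variable {σ R : Type*} [CommRing R]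

theorem pderiv_pderiv_comm (i j : σ) (p : MvPolynomial σ R) :
    pderiv i (pderiv j p) = pderiv j (pderiv i p) := by
  classical
  have h : ⁅pderiv i, pderiv j⁆ = (0 : Derivation R (MvPolynomial σ R) (MvPolynomial σ R)) :=
    derivation_ext fun k => by
      rw [Derivation.commutator_apply, pderiv_X, pderiv_X, Pi.single_apply, Pi.single_apply]
      split_ifs <;> simp
  exact sub_eq_zero.1 (DFunLike.congr_fun h p)

/-- The derivation `xᵢ ∂ⱼ - xⱼ ∂ᵢ`, the derivative along the rotations in the plane of the
coordinates `i` and `j`. -/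
def angMomentum (i j : σ) : Derivation R (MvPolynomial σ R) (MvPolynomial σ R) :=
  (X i : MvPolynomial σ R) • pderiv j - (X j : MvPolynomial σ R) • pderiv i

theorem angMomentum_apply (i j : σ) (p : MvPolynomial σ R) :
    angMomentum i j p = X i * pderiv j p - X j * pderiv i p := rfl

variable [Fintype σ]

/-- The Laplacian `∑ᵢ ∂ᵢ²` on polynomials. -/
def polyLaplacian : MvPolynomial σ R →ₗ[R] MvPolynomial σ R :=
  ∑ i, (pderiv i).toLinearMap ∘ₗ (pderiv i).toLinearMap

theorem polyLaplacian_apply (p : MvPolynomial σ R) :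
    polyLaplacian p = ∑ i, pderiv i (pderiv i p) := by
  simp [polyLaplacian, LinearMap.sum_apply]

theorem isHomogeneous_polyLaplacian {n : ℕ} {p : MvPolynomial σ R} (hp : p.IsHomogeneous n) :
    (polyLaplacian p).IsHomogeneous (n - 2) := by
  rw [polyLaplacian_apply]
  exact .sum _ _ _ fun i _ => hp.pderiv.pderiv

theorem polyLaplacian_eq_zero_of_isHomogeneous_of_lt_two {n : ℕ} {p : MvPolynomial σ R}
    (hp : p.IsHomogeneous n) (hn : n < 2) : polyLaplacian p = 0 := by
  rw [polyLaplacian_apply]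
  refine Finset.sum_eq_zero fun i _ => ?_
  have h : (pderiv i p).IsHomogeneous 0 := by
    simpa only [show n - 1 = 0 by omega] using hp.pderiv (i := i)
  rw [totalDegree_eq_zero_iff_eq_C.1 ((totalDegree_zero_iff_isHomogeneous σ).2 h),
    pderiv_C]

variable (σ R) in
/-- The harmonic homogeneous polynomials of degree `n`. -/
def harmonicSubmodule (n : ℕ) : Submodule R (MvPolynomial σ R) :=
  homogeneousSubmodule σ R n ⊓ LinearMap.ker polyLaplacian

theorem mem_harmonicSubmodule {n : ℕ} {p : MvPolynomial σ R} :
    p ∈ harmonicSubmodule σ R n ↔ p.IsHomogeneous n ∧ polyLaplacian p = 0 := Iff.rfl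

variable (σ R) in
/-- The polynomial `|x|²`. -/
def normSqPoly : MvPolynomial σ R := ∑ i, X i ^ 2

theorem isHomogeneous_normSqPoly : (normSqPoly σ R).IsHomogeneous 2 :=
  .sum _ _ _ fun i _ => by simpa using (isHomogeneous_X R i).pow 2

theorem pderiv_normSqPoly (i : σ) : pderiv i (normSqPoly σ R) = 2 * X i := by
  classical
  simp [normSqPoly, pderiv_X, Pi.single_apply]

theorem polyLaplacian_normSqPoly_mul {n : ℕ} {q : MvPolynomial σ R} (hq : q.IsHomogeneous n) :
    polyLaplacian (normSqPoly σ R * q)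
      = (4 * n + 2 * Fintype.card σ) • q + normSqPoly σ R * polyLaplacian q := by
  have h2 : ∀ i, pderiv i (2 : MvPolynomial σ R) = 0 := fun i => (pderiv i).map_natCast 2
  have hterm : ∀ i, pderiv i (pderiv i (normSqPoly σ R * q))
      = 2 * q + 4 * (X i * pderiv i q) + normSqPoly σ R * pderiv i (pderiv i q) := fun i => by
    simp only [pderiv_mul, map_add, pderiv_normSqPoly, pderiv_X_self, h2]
    ring
  simp only [polyLaplacian_apply, hterm, Finset.sum_add_distrib, ← Finset.mul_sum,
    hq.sum_X_mul_pderiv, Finset.sum_const, Finset.card_univ, nsmul_eq_mul]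
  push_cast
  ring

theorem sum_X_mul_sum_X_mul_pderiv_pderiv {n : ℕ} {p : MvPolynomial σ R} (hp : p.IsHomogeneous n) :
    ∑ i, ∑ j, X i * X j * pderiv i (pderiv j p) = (n * (n - 1) : MvPolynomial σ R) * p := by
  classical
  have hEuler := hp.sum_X_mul_pderiv
  have hi : ∀ i, ∑ j, X j * pderiv i (pderiv j p) = (n - 1 : MvPolynomial σ R) * pderiv i p := by
    intro i
    have h := congrArg (pderiv i) hEuler
    simp only [map_sum, pderiv_mul, pderiv_X, Pi.single_apply, ite_mul, one_mul, zero_mul,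
      Finset.sum_add_distrib, Finset.sum_ite_eq', Finset.mem_univ, if_true, map_nsmul] at h
    rw [nsmul_eq_mul] at h
    linear_combination h
  calc ∑ i, ∑ j, X i * X j * pderiv i (pderiv j p)
      = ∑ i, (n - 1 : MvPolynomial σ R) * (X i * pderiv i p) := by
        refine Finset.sum_congr rfl fun i _ => ?_
        rw [mul_left_comm, ← hi, Finset.mul_sum]
        simp only [mul_assoc]
    _ = (n * (n - 1) : MvPolynomial σ R) * p := by
        rw [← Finset.mul_sum, hEuler, nsmul_eq_mul]
        ring

theorem sum_angMomentum_sq {n : ℕ} {p : MvPolynomial σ R} (hp : p.IsHomogeneous n) :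
    ∑ i, ∑ j, angMomentum i j (angMomentum i j p)
      = 2 * (normSqPoly σ R * polyLaplacian p
          - (n * (n + Fintype.card σ - 2) : MvPolynomial σ R) * p) := by
  classical
  have hterm : ∀ i j, angMomentum i j (angMomentum i j p)
      = X i ^ 2 * pderiv j (pderiv j p) + X j ^ 2 * pderiv i (pderiv i p)
        - X i * pderiv i p - X j * pderiv j p
        - 2 * (X i * X j * pderiv i (pderiv j p))
        + (if i = j then 2 * (X i * pderiv i p) else 0) := fun i j => by
    rcases eq_or_ne i j with rfl | hij
    · simp only [angMomentum_apply, sub_self, if_true, map_zero]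
      ring
    · simp only [angMomentum_apply, map_sub, pderiv_mul, pderiv_X_self, pderiv_X_of_ne hij,
        pderiv_X_of_ne hij.symm, if_neg hij, pderiv_pderiv_comm j i]
      ring
  have hEuler := hp.sum_X_mul_pderiv
  rw [nsmul_eq_mul] at hEuler
  have hnorm : ∑ i, X i ^ 2 = normSqPoly σ R := rfl
  simp only [hterm, Finset.sum_add_distrib, Finset.sum_sub_distrib, ← Finset.mul_sum,
    ← Finset.sum_mul, Finset.sum_ite_eq, Finset.mem_univ, if_true, Finset.sum_const,
    Finset.card_univ, nsmul_eq_mul, sum_X_mul_sum_X_mul_pderiv_pderiv hp, hEuler,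
    mul_left_comm (X _) (Fintype.card σ : MvPolynomial σ R), ← polyLaplacian_apply, hnorm]
  ring

theorem pow_isotropic_mem_harmonicSubmodule {a : σ → R} (ha : ∑ i, a i ^ 2 = 0) (n : ℕ) :
    (∑ i, C (a i) * X i) ^ n ∈ harmonicSubmodule σ R n := by
  classical
  set ℓ : MvPolynomial σ R := ∑ i, C (a i) * X i with hℓ
  have hderiv : ∀ i, pderiv i ℓ = C (a i) := fun i => by
    simp [hℓ, pderiv_X, Pi.single_apply]
  refine mem_harmonicSubmodule.2 ⟨?_, ?_⟩
  · simpa only [one_mul] using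
      (IsHomogeneous.sum _ _ 1 fun i _ => (isHomogeneous_X R i).C_mul (a i)).pow n
  · have hterm : ∀ i, pderiv i (pderiv i (ℓ ^ n))
        = ((n : MvPolynomial σ R) * ((n - 1 : ℕ) : MvPolynomial σ R) * ℓ ^ (n - 1 - 1))
          * C (a i ^ 2) := fun i => by
      simp only [pderiv_pow, pderiv_mul, hderiv, pderiv_C, Derivation.map_natCast, map_pow]
      ring
    simp only [polyLaplacian_apply, hterm, ← Finset.mul_sum, ← map_sum, ha, map_zero, mul_zero]

end PolynomialLaplacian

section FischerDecomposition

variable {σ K : Type*} [Fintype σ] [Field K] [CharZero K]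

theorem exists_nsmul_add_normSqPoly_mul_polyLaplacian_eq {n a : ℕ} (ha : a ≠ 0)
    {q : MvPolynomial σ K} (hq : q.IsHomogeneous n) :
    ∃ u : MvPolynomial σ K, u.IsHomogeneous n ∧
      a • u + normSqPoly σ K * polyLaplacian u = q := by
  induction n using Nat.strong_induction_on generalizing a q with
  | _ n ih =>
    have ha' : (a : K) ≠ 0 := Nat.cast_ne_zero.2 ha
    have hcancel : ∀ p : MvPolynomial σ K, a • (a : K)⁻¹ • p = p := fun p => by
      rw [← Nat.cast_smul_eq_nsmul K, smul_inv_smul₀ ha']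
    rcases lt_or_ge n 2 with hn | hn
    · refine ⟨(a : K)⁻¹ • q, (homogeneousSubmodule σ K n).smul_mem _ hq, ?_⟩
      rw [hcancel, map_smul, polyLaplacian_eq_zero_of_isHomogeneous_of_lt_two hq hn, smul_zero,
        mul_zero, add_zero]
    · obtain ⟨w, hw, hwq⟩ := ih (n - 2) (by omega)
        (a := a + (4 * (n - 2) + 2 * Fintype.card σ)) (by omega) (isHomogeneous_polyLaplacian hq)
      have hmul : (normSqPoly σ K * w).IsHomogeneous n := by
        simpa only [Nat.add_sub_of_le hn] using isHomogeneous_normSqPoly.mul hw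
      have hΔ : polyLaplacian ((a : K)⁻¹ • (q - normSqPoly σ K * w)) = w := by
        have h : polyLaplacian (q - normSqPoly σ K * w) = a • w := by
          rw [map_sub, polyLaplacian_normSqPoly_mul hw, ← hwq, add_smul]
          abel
        rw [map_smul, h, ← Nat.cast_smul_eq_nsmul K, inv_smul_smul₀ ha']
      refine ⟨(a : K)⁻¹ • (q - normSqPoly σ K * w),
        (homogeneousSubmodule σ K n).smul_mem _ (hq.sub hmul), ?_⟩
      rw [hΔ, hcancel, sub_add_cancel]

theorem exists_harmonic_add_normSqPoly_mul [Nonempty σ] {n : ℕ} {p : MvPolynomial σ K}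
    (hp : p.IsHomogeneous (n + 2)) :
    ∃ h ∈ harmonicSubmodule σ K (n + 2), ∃ q : MvPolynomial σ K, q.IsHomogeneous n ∧
      p = h + normSqPoly σ K * q := by
  have hc : 4 * n + 2 * Fintype.card σ ≠ 0 := by have := Fintype.card_pos (α := σ); omega
  have hΔ : (polyLaplacian p).IsHomogeneous n := isHomogeneous_polyLaplacian hp
  obtain ⟨q, hq, hqp⟩ := exists_nsmul_add_normSqPoly_mul_polyLaplacian_eq hc hΔ
  refine ⟨p - normSqPoly σ K * q, mem_harmonicSubmodule.2 ⟨hp.sub ?_, ?_⟩, q, hq, by ring⟩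
  · simpa only [add_comm] using isHomogeneous_normSqPoly.mul hq
  · rw [map_sub, polyLaplacian_normSqPoly_mul hq, hqp]
    exact sub_self _

end FischerDecomposition

section Dimension

variable {K : Type*} [Field K]

/-- The exponent vector `(a, b, c)`. -/
def expVec (a b c : ℕ) : Fin 3 →₀ ℕ := Finsupp.equivFunOnFinite.symm ![a, b, c]

theorem coeff_polyLaplacian_expVec (p : MvPolynomial (Fin 3) K) (a b c : ℕ) :
    (polyLaplacian p).coeff (expVec a b c)
      = p.coeff (expVec (a + 2) b c) * ((a + 2) * (a + 1))
        + p.coeff (expVec a (b + 2) c) * ((b + 2) * (b + 1))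
        + p.coeff (expVec a b (c + 2)) * ((c + 2) * (c + 1)) := by
  have h0 : ∀ a, expVec a b c + Finsupp.single 0 1 = expVec (a + 1) b c := fun a => by
    ext i; fin_cases i <;> simp [expVec]
  have h1 : ∀ b, expVec a b c + Finsupp.single 1 1 = expVec a (b + 1) c := fun b => by
    ext i; fin_cases i <;> simp [expVec]
  have h2 : ∀ c, expVec a b c + Finsupp.single 2 1 = expVec a b (c + 1) := fun c => by
    ext i; fin_cases i <;> simp [expVec]
  simp only [polyLaplacian_apply, Fin.sum_univ_three, coeff_add, coeff_pderiv, h0, h1, h2]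
  simp only [expVec, Finsupp.equivFunOnFinite_symm_apply_apply, Matrix.cons_val_zero, Nat.cast_add,
    Nat.cast_one, Matrix.cons_val_one, Matrix.cons_val]
  ring

theorem coeff_expVec_eq_zero {n : ℕ} {p : MvPolynomial (Fin 3) K} (hp : p.IsHomogeneous n)
    {a b c : ℕ} (h : a + b + c ≠ n) : p.coeff (expVec a b c) = 0 := by
  refine hp.coeff_eq_zero ?_
  rw [Finsupp.degree_eq_sum, Fin.sum_univ_three]
  simpa [expVec] using h

/-- The coefficients of degree at most one in the last variable. -/
def lowCoeffs (n : ℕ) : harmonicSubmodule (Fin 3) K n →ₗ[K] (Fin (n + 1) ⊕ Fin n → K) where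
  toFun p := Sum.elim (fun a => p.1.coeff (expVec a (n - a) 0))
    (fun a => p.1.coeff (expVec a (n - 1 - a) 1))
  map_add' p q := by ext (i | i) <;> simp
  map_smul' c p := by ext (i | i) <;> simp

variable [CharZero K]

/-- The Laplace equation determines the coefficients recursively in the exponent of the last
variable. -/
theorem eq_zero_of_polyLaplacian_eq_zero {p : MvPolynomial (Fin 3) K} (hp : polyLaplacian p = 0)
    (h0 : ∀ a b, p.coeff (expVec a b 0) = 0) (h1 : ∀ a b, p.coeff (expVec a b 1) = 0) : p = 0 := by
  have h : ∀ c a b, p.coeff (expVec a b c) = 0 := by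
    intro c
    induction c using Nat.strong_induction_on with
    | _ c ih =>
      intro a b
      rcases c with _ | _ | c
      · exact h0 a b
      · exact h1 a b
      · have hc : ((c : K) + 2) * (c + 1) ≠ 0 := by
          exact_mod_cast (by positivity : (c + 2) * (c + 1) ≠ 0)
        have h2 := coeff_polyLaplacian_expVec p a b c
        rw [hp, coeff_zero, ih c (by omega), ih c (by omega), zero_mul, zero_mul, zero_add,
          zero_add] at h2
        exact (mul_eq_zero.1 h2.symm).resolve_right hc
  ext m
  have hm : m = expVec (m 0) (m 1) (m 2) := by
    ext i
    fin_cases i <;> simp [expVec]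
  rw [hm, h, coeff_zero]

theorem lowCoeffs_injective (n : ℕ) : Function.Injective (lowCoeffs (K := K) n) := by
  refine (injective_iff_map_eq_zero _).2 fun p hp => ?_
  obtain ⟨hhom, hΔ⟩ := mem_harmonicSubmodule.1 p.2
  refine Subtype.ext (eq_zero_of_polyLaplacian_eq_zero hΔ (fun a b => ?_) fun a b => ?_)
  · by_cases h : a + b + 0 = n
    · have h1 := congrFun hp (Sum.inl ⟨a, by omega⟩)
      simpa only [lowCoeffs, LinearMap.coe_mk, AddHom.coe_mk, Sum.elim_inl, Pi.zero_apply,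
        show n - a = b by omega] using h1
    · exact coeff_expVec_eq_zero hhom h
  · by_cases h : a + b + 1 = n
    · have h1 := congrFun hp (Sum.inr ⟨a, by omega⟩)
      simpa only [lowCoeffs, LinearMap.coe_mk, AddHom.coe_mk, Sum.elim_inr, Pi.zero_apply,
        show n - 1 - a = b by omega] using h1
    · exact coeff_expVec_eq_zero hhom h

instance finiteDimensional_harmonicSubmodule (n : ℕ) :
    FiniteDimensional K (harmonicSubmodule (Fin 3) K n) :=
  .of_injective (lowCoeffs n) (lowCoeffs_injective n)

theorem finrank_harmonicSubmodule_le (n : ℕ) :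
    Module.finrank K (harmonicSubmodule (Fin 3) K n) ≤ 2 * n + 1 := by
  refine (LinearMap.finrank_le_finrank_of_injective (lowCoeffs_injective n)).trans ?_
  simp only [Module.finrank_fintype_fun_eq_card, Fintype.card_sum, Fintype.card_fin]
  omega

end Dimension

section SphericalLaplacian

variable {ι : Type*} [Fintype ι]

/-- The restriction of polynomials with complex coefficients to the unit sphere. -/
def restrictSphere : MvPolynomial ι ℂ →ₐ[ℂ] C(UnitSphere (EuclideanSpace ℝ ι), ℂ) :=
  aeval fun i => ⟨fun ω => ((ω.1 i : ℝ) : ℂ), by fun_prop⟩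

theorem restrictSphere_X (i : ι) (ω : UnitSphere (EuclideanSpace ℝ ι)) :
    restrictSphere (X i) ω = ((ω.1 i : ℝ) : ℂ) := by
  simp [restrictSphere]

theorem restrictSphere_eq_eval (p : MvPolynomial ι ℂ) (ω : UnitSphere (EuclideanSpace ℝ ι)) :
    restrictSphere p ω = eval (fun i => ((ω.1 i : ℝ) : ℂ)) p := by
  induction p using MvPolynomial.induction_on with
  | C a => simp [restrictSphere]
  | add p q hp hq => simp [hp, hq]
  | mul_X p i hp => simp [hp, restrictSphere_X]

theorem UnitSphere.sum_coord_sq (ω : UnitSphere (EuclideanSpace ℝ ι)) :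
    ∑ i, ω.1 i ^ 2 = 1 := by
  rw [← EuclideanSpace.real_norm_sq_eq, ω.norm_coe, one_pow]

theorem restrictSphere_normSqPoly :
    restrictSphere (normSqPoly ι ℂ) = 1 := by
  ext ω
  simp only [normSqPoly, map_sum, map_pow, ContinuousMap.sum_apply, ContinuousMap.pow_apply,
    restrictSphere_X, ContinuousMap.one_apply]
  exact_mod_cast ω.sum_coord_sq

variable [DecidableEq ι]

/-- The infinitesimal rotation `y ↦ yᵢ eⱼ - yⱼ eᵢ`. -/
def rotGenerator (i j : ι) : skewAdjoint (EuclideanSpace ℝ ι →L[ℝ] EuclideanSpace ℝ ι) :=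
  ⟨(EuclideanSpace.proj i).smulRight (EuclideanSpace.single j (1 : ℝ))
    - (EuclideanSpace.proj j).smulRight (EuclideanSpace.single i (1 : ℝ)), by
    rw [skewAdjoint.mem_iff, ContinuousLinearMap.star_eq_adjoint, eq_comm,
      ContinuousLinearMap.eq_adjoint_iff]
    intro x y
    simp only [neg_sub, sub_apply, ContinuousLinearMap.smulRight_apply, PiLp.proj_apply,
      inner_sub_left, inner_smul_left, Real.ringHom_apply, EuclideanSpace.inner_single_left,
      one_mul, inner_sub_right, inner_smul_right, EuclideanSpace.inner_single_right]
    ring⟩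

theorem rotGenerator_apply (i j : ι) (y : EuclideanSpace ℝ ι) :
    (rotGenerator i j).1 y
      = y i • EuclideanSpace.single j (1 : ℝ) - y j • EuclideanSpace.single i (1 : ℝ) := rfl

theorem inner_rotGenerator (i j : ι) (x y : EuclideanSpace ℝ ι) :
    inner ℝ x ((rotGenerator i j).1 y)
      = y i * x j - y j * x i := by
  simp [rotGenerator_apply, inner_sub_right, inner_smul_right, EuclideanSpace.inner_single_right]

theorem sum_inner_rotGenerator_sq (ξ ω : UnitSphere (EuclideanSpace ℝ ι)) :
    ∑ i, ∑ j, inner ℝ ξ.1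
        ((rotGenerator i j).1 ω.1) ^ 2
      = 2 * (1 - inner ℝ ξ.1 ω.1 ^ 2) := by
  have hexpand : ∀ i j, inner ℝ ξ.1
        ((rotGenerator i j).1 ω.1) ^ 2
      = ω.1 i ^ 2 * ξ.1 j ^ 2 + ξ.1 i ^ 2 * ω.1 j ^ 2
        - 2 * (ω.1 i * ξ.1 i * (ω.1 j * ξ.1 j)) := fun i j => by
    rw [inner_rotGenerator]
    ring
  have hinner : ∑ i, ω.1 i * ξ.1 i = inner ℝ ξ.1 ω.1 := by
    simp [PiLp.inner_apply]
  simp only [hexpand, Finset.sum_sub_distrib, Finset.sum_add_distrib, ← Finset.mul_sum,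
    ← Finset.sum_mul, ξ.sum_coord_sq, ω.sum_coord_sq, hinner]
  ring

theorem sum_inner_rotGenerator_rotGenerator (x y : EuclideanSpace ℝ ι) :
    ∑ i, ∑ j, inner ℝ ((rotGenerator i j).1 x)
        ((rotGenerator i j).1 y)
      = 2 * ((Fintype.card ι - 1) * inner ℝ x y) := by
  have hexpand : ∀ i j,
      inner ℝ ((rotGenerator i j).1 x)
        ((rotGenerator i j).1 y)
      = x i * y i + x j * y j - (if i = j then 2 * (x i * y i) else 0) := fun i j => by
    rw [inner_rotGenerator, rotGenerator_apply]
    rcases eq_or_ne i j with rfl | h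
    · simp only [sub_self, PiLp.zero_apply, mul_zero, ↓reduceIte]
      ring
    · simp [h, h.symm, mul_comm]
  have hinner : ∑ i, x i * y i = inner ℝ x y := by simp [PiLp.inner_apply, mul_comm]
  simp only [hexpand, Finset.sum_sub_distrib, Finset.sum_add_distrib, Finset.sum_const,
    Finset.sum_ite_eq, Finset.mem_univ, if_true, ← Finset.mul_sum, hinner,
    Finset.card_univ, nsmul_eq_mul]
  ring

theorem hasRotDeriv_restrictSphere (i j : ι) (p : MvPolynomial ι ℂ) :
    HasRotDeriv (rotGenerator i j) (restrictSphere p) (restrictSphere (angMomentum i j p)) := by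
  have hX : ∀ k, HasRotDeriv (rotGenerator i j) (restrictSphere (X k))
      (restrictSphere (angMomentum i j (X k))) := fun k => by
    have h := (HasRotDeriv.inner_right (rotGenerator i j) (EuclideanSpace.single k 1)).ofReal
    convert h using 1 <;> funext ω
    · simp [restrictSphere_X, EuclideanSpace.inner_single_left]
    · rw [inner_rotGenerator]
      rcases eq_or_ne k i with rfl | hi <;> rcases eq_or_ne k j with rfl | hj <;>
        simp [angMomentum_apply, restrictSphere_X, *]
  induction p using MvPolynomial.induction_on with
  | C a =>
    simp only [algHom_C, derivation_C, map_zero]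
    exact ⟨continuous_const, continuous_const, fun _ => hasDerivAt_const _ _⟩
  | add p q hp hq => simpa only [map_add, ContinuousMap.coe_add] using hp.add hq
  | mul_X p k hp =>
    simpa only [map_mul, Derivation.leibniz, map_add, ContinuousMap.coe_mul,
      ContinuousMap.coe_add, smul_eq_mul, add_comm, mul_comm] using hp.mul (hX k)

/-- `f` is twice differentiable along rotations and its spherical Laplacian, that is, half the sum
of its second derivatives along all `rotGenerator i j`, is `Lf`. -/
def HasSphericalLaplacian (f Lf : UnitSphere (EuclideanSpace ℝ ι) → ℂ) : Prop :=
  ∃ f₁ f₂ : ι → ι → UnitSphere (EuclideanSpace ℝ ι) → ℂ,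
    (∀ i j, HasRotDeriv (rotGenerator i j) f (f₁ i j)) ∧
    (∀ i j, HasRotDeriv (rotGenerator i j) (f₁ i j) (f₂ i j)) ∧
    ∀ ω, ∑ i, ∑ j, f₂ i j ω = 2 * Lf ω

theorem HasSphericalLaplacian.integral_mul_comm {f Lf g Lg : UnitSphere (EuclideanSpace ℝ ι) → ℂ}
    (hf : HasSphericalLaplacian f Lf) (hg : HasSphericalLaplacian g Lg) :
    ∫ ω, Lf ω * g ω ∂sphereMeasure _ = ∫ ω, f ω * Lg ω ∂sphereMeasure _ := by
  obtain ⟨f₁, f₂, hf₁, hf₂, hfL⟩ := hf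
  obtain ⟨g₁, g₂, hg₁, hg₂, hgL⟩ := hg
  have hparts : ∀ i j, ∫ ω, f₂ i j ω * g ω ∂sphereMeasure _
      = ∫ ω, f ω * g₂ i j ω ∂sphereMeasure _ := fun i j => by
    rw [(hf₂ i j).integral_deriv_mul (hg₁ i j), (hf₁ i j).integral_deriv_mul (hg₂ i j), neg_neg]
  have hsum : ∀ {u : ι → ι → UnitSphere (EuclideanSpace ℝ ι) → ℂ}, (∀ i j, Continuous (u i j)) →
      ∫ ω, ∑ i, ∑ j, u i j ω ∂sphereMeasure _ = ∑ i, ∑ j, ∫ ω, u i j ω ∂sphereMeasure _ :=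
    fun hu => by
      rw [integral_finsetSum _ fun i _ => integrable_sphereMeasure
        (continuous_finsetSum _ fun j _ => hu i j)]
      exact Finset.sum_congr rfl fun i _ =>
        integral_finsetSum _ fun j _ => integrable_sphereMeasure (hu i j)
  refine mul_left_cancel₀ (two_ne_zero (α := ℂ)) ?_
  calc 2 * ∫ ω, Lf ω * g ω ∂sphereMeasure _
      = ∑ i, ∑ j, ∫ ω, f₂ i j ω * g ω ∂sphereMeasure _ := by
        rw [← hsum (u := fun i j ω => f₂ i j ω * g ω)
          fun i j => (hf₂ i j).continuous_deriv.mul (hg₁ i j).continuous, ← integral_const_mul]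
        simp only [← mul_assoc, ← hfL, Finset.sum_mul]
    _ = ∑ i, ∑ j, ∫ ω, f ω * g₂ i j ω ∂sphereMeasure _ := by simp only [hparts]
    _ = 2 * ∫ ω, f ω * Lg ω ∂sphereMeasure _ := by
        rw [← hsum (u := fun i j ω => f ω * g₂ i j ω)
          fun i j => (hf₁ i j).continuous.mul (hg₂ i j).continuous_deriv, ← integral_const_mul]
        simp only [mul_left_comm (2 : ℂ), ← hgL, Finset.mul_sum]

theorem hasSphericalLaplacian_zonal {F F' F'' : ℝ → ℝ}
    (hF : ∀ t ∈ Set.Icc (-1 : ℝ) 1, HasDerivAt F (F' t) t)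
    (hF' : ∀ t ∈ Set.Icc (-1 : ℝ) 1, HasDerivAt F' (F'' t) t)
    (hF'' : ContinuousOn F'' (Set.Icc (-1) 1)) (ξ : UnitSphere (EuclideanSpace ℝ ι)) :
    HasSphericalLaplacian (fun ω => (F (inner ℝ ξ.1 ω.1) : ℂ)) fun ω =>
      (((1 - inner ℝ ξ.1 ω.1 ^ 2) * F'' (inner ℝ ξ.1 ω.1)
        - (Fintype.card ι - 1) * inner ℝ ξ.1 ω.1 * F' (inner ℝ ξ.1 ω.1) : ℝ) : ℂ) := by
  have hF'c : ContinuousOn F' (Set.Icc (-1) 1) := fun t ht =>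
    (hF' t ht).continuousAt.continuousWithinAt
  have hskew : ∀ i j, HasRotDeriv (rotGenerator i j)
      (fun ω => inner ℝ ξ.1 ((rotGenerator i j).1 ω.1))
      fun ω => -inner ℝ ((rotGenerator i j).1 ξ.1) ((rotGenerator i j).1 ω.1) := fun i j => by
    have h := HasRotDeriv.inner_right (rotGenerator i j) (-(rotGenerator i j).1 ξ.1)
    convert h using 2 with ω ω
    · rw [inner_neg_left, inner_rotGenerator, real_inner_comm, inner_rotGenerator]
      ring
    · rw [inner_neg_left]
  refine ⟨_, _, fun i j => (HasRotDeriv.comp_inner hF hF'c ξ).ofReal,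
    fun i j => ((HasRotDeriv.comp_inner hF' hF'' ξ).mul (hskew i j)).ofReal, fun ω => ?_⟩
  have h₁ := sum_inner_rotGenerator_sq ξ ω
  have h₂ := sum_inner_rotGenerator_rotGenerator ξ.1 ω.1
  simp only [Pi.add_apply, Pi.mul_apply, mul_assoc, ← sq, mul_neg, ← sub_eq_add_neg]
  rw [← Complex.ofReal_ofNat, ← Complex.ofReal_mul]
  simp only [← Complex.ofReal_sum]
  refine congrArg Complex.ofReal ?_
  simp only [Finset.sum_sub_distrib, ← Finset.mul_sum, h₁, h₂]
  ring

theorem hasSphericalLaplacian_restrictSphere {n : ℕ} {p : MvPolynomial ι ℂ}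
    (hp : p ∈ harmonicSubmodule ι ℂ n) :
    HasSphericalLaplacian (restrictSphere p)
      fun ω => -(n * (n + Fintype.card ι - 2)) * restrictSphere p ω := by
  refine ⟨_, _, fun i j => hasRotDeriv_restrictSphere i j p,
    fun i j => hasRotDeriv_restrictSphere i j _, fun ω => ?_⟩
  obtain ⟨hhom, hΔ⟩ := mem_harmonicSubmodule.1 hp
  have h := congrArg (fun q => restrictSphere q ω) (sum_angMomentum_sq hhom)
  have h2 : restrictSphere (2 : MvPolynomial ι ℂ) ω = 2 := by
    rw [map_ofNat]
    rfl
  simpa [hΔ, h2] using h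

omit [DecidableEq ι] in
theorem integral_restrictSphere_mul_eq_zero [Nontrivial ι] {m n : ℕ} (hmn : m ≠ n)
    {p q : MvPolynomial ι ℂ} (hp : p ∈ harmonicSubmodule ι ℂ m) (hq : q ∈ harmonicSubmodule ι ℂ n) :
    ∫ ω, restrictSphere p ω * restrictSphere q ω ∂sphereMeasure _ = 0 := by
  classical
  have h := (hasSphericalLaplacian_restrictSphere hp).integral_mul_comm
    (hasSphericalLaplacian_restrictSphere hq)
  simp only [mul_assoc, mul_left_comm (restrictSphere p _), integral_const_mul] at h
  rw [← sub_eq_zero, ← sub_mul] at h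
  refine (mul_eq_zero.1 h).resolve_left fun h0 => hmn ?_
  have hcard : 2 ≤ Fintype.card ι := Fintype.one_lt_card
  have hfactor : ((n : ℤ) - m) * (n + m + (Fintype.card ι - 2)) = 0 := by
    have h1 : ((n : ℂ) - m) * (n + m + (Fintype.card ι - 2)) = 0 := by linear_combination h0
    exact_mod_cast h1
  rcases mul_eq_zero.1 hfactor with h1 | h1 <;> omega

end SphericalLaplacian

section InvDist

/-- For unit vectors `ξ`, `ω` with inner product `t`, the inverse distance of `s ξ` and `ω`. -/
def invDist (s t : ℝ) : ℝ := (√(1 + s ^ 2 - 2 * s * t))⁻¹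

variable {s t : ℝ}

theorem invDist_nonneg (s t : ℝ) : 0 ≤ invDist s t := inv_nonneg.2 (Real.sqrt_nonneg _)

theorem sq_one_sub_abs_le (s : ℝ) (ht : t ∈ Set.Icc (-1 : ℝ) 1) :
    (1 - |s|) ^ 2 ≤ 1 + s ^ 2 - 2 * s * t := by
  have h : s * t ≤ |s| := calc
    s * t ≤ |s * t| := le_abs_self _
    _ = |s| * |t| := abs_mul _ _
    _ ≤ |s| := mul_le_of_le_one_right (abs_nonneg _) (abs_le.2 ht)
  nlinarith [sq_abs s]

theorem invDist_radicand_pos (hs : |s| ≠ 1) (ht : t ∈ Set.Icc (-1 : ℝ) 1) :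
    0 < 1 + s ^ 2 - 2 * s * t :=
  (sq_pos_of_ne_zero (sub_ne_zero.2 hs.symm)).trans_le (sq_one_sub_abs_le s ht)

theorem invDist_eq_pow_mul (h : 0 < 1 + s ^ 2 - 2 * s * t) :
    invDist s t = invDist s t ^ 3 * (1 + s ^ 2 - 2 * s * t) := by
  have hsq : invDist s t ^ 2 * (1 + s ^ 2 - 2 * s * t) = 1 := by
    rw [invDist, inv_pow, Real.sq_sqrt h.le, inv_mul_cancel₀ h.ne']
  linear_combination -invDist s t * hsq

theorem invDist_inv (hs : 0 < s) (t : ℝ) : invDist s t = s⁻¹ * invDist s⁻¹ t := by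
  have h : 1 + s ^ 2 - 2 * s * t = s ^ 2 * (1 + s⁻¹ ^ 2 - 2 * s⁻¹ * t) := by
    field_simp
    ring
  rw [invDist, invDist, ← mul_inv, h, Real.sqrt_mul (sq_nonneg s), Real.sqrt_sq hs.le]

theorem hasDerivAt_inv_sqrt {q : ℝ → ℝ} {q' x : ℝ} (h : HasDerivAt q q' x) (hq : 0 < q x) :
    HasDerivAt (fun x => (√(q x))⁻¹) (-(q' / 2) * (√(q x))⁻¹ ^ 3) x := by
  have hpos := Real.sqrt_pos.2 hq
  refine ((h.sqrt hq.ne').inv hpos.ne').congr_deriv ?_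
  field_simp

theorem hasDerivAt_invDist_left (h : 0 < 1 + s ^ 2 - 2 * s * t) :
    HasDerivAt (fun s => invDist s t) ((t - s) * invDist s t ^ 3) s := by
  have hq : HasDerivAt (fun s : ℝ => 1 + s ^ 2 - 2 * s * t) (2 * s - 2 * t) s := by
    refine ((((hasDerivAt_id s).pow 2).const_add 1).sub
      (((hasDerivAt_id s).const_mul 2).mul_const t)).congr_deriv ?_
    simp
  refine (hasDerivAt_inv_sqrt hq h).congr_deriv ?_
  unfold invDist
  ring

theorem hasDerivAt_invDist_right (h : 0 < 1 + s ^ 2 - 2 * s * t) :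
    HasDerivAt (fun t => invDist s t) (s * invDist s t ^ 3) t := by
  have hq : HasDerivAt (fun t : ℝ => 1 + s ^ 2 - 2 * s * t) (-(2 * s)) t := by
    simpa using ((hasDerivAt_id t).const_mul (2 * s)).const_sub (1 + s ^ 2)
  refine (hasDerivAt_inv_sqrt hq h).congr_deriv ?_
  unfold invDist
  ring

theorem continuousOn_uncurry_invDist :
    ContinuousOn (fun z : ℝ × ℝ => invDist z.1 z.2) ({s | |s| ≠ 1} ×ˢ Set.Icc (-1 : ℝ) 1) := by
  unfold invDist
  exact ContinuousOn.inv₀ (by fun_prop) fun z hz =>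
    (Real.sqrt_pos.2 (invDist_radicand_pos hz.1 hz.2)).ne'

theorem continuousOn_invDist (hs : |s| ≠ 1) : ContinuousOn (invDist s) (Set.Icc (-1 : ℝ) 1) :=
  fun _ ht =>
    (hasDerivAt_invDist_right (invDist_radicand_pos hs ht)).continuousAt.continuousWithinAt

theorem invDist_le_two_mul (hs : s ∈ Set.Ioo (0 : ℝ) 1) (ht : t ∈ Set.Ico (-1 : ℝ) 1) :
    invDist s t ≤ 2 * invDist 1 t := by
  have hq : 0 < 1 + (1 : ℝ) ^ 2 - 2 * 1 * t := by linarith [ht.2]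
  have hle : (1 + (1 : ℝ) ^ 2 - 2 * 1 * t) / 2 ^ 2 ≤ 1 + s ^ 2 - 2 * s * t := by
    nlinarith [mul_nonneg (sub_nonneg.2 ht.2.le) hs.1.le, sq_nonneg (1 - s), hs.2, ht.1]
  calc invDist s t ≤ (√((1 + (1 : ℝ) ^ 2 - 2 * 1 * t) / 2 ^ 2))⁻¹ := by
        unfold invDist
        gcongr
    _ = 2 * invDist 1 t := by
        rw [Real.sqrt_div hq.le, Real.sqrt_sq two_pos.le, inv_div, div_eq_mul_inv, invDist]

theorem invDist_one_inner {V : Type*} [NormedAddCommGroup V] [InnerProductSpace ℝ V]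
    (ξ ω : UnitSphere V) : invDist 1 (inner ℝ ξ.1 ω.1) = ‖ξ.1 - ω.1‖⁻¹ := by
  rw [invDist, ← Real.sqrt_sq (norm_nonneg (ξ.1 - ω.1)), norm_sub_sq_real, ξ.norm_coe, ω.norm_coe]
  ring_nf

end InvDist

section ZonalIntegral

variable {V : Type*} [NormedAddCommGroup V] [InnerProductSpace ℝ V] (ξ : UnitSphere V)
  (f : C(UnitSphere V, ℂ)) {F G : ℝ → ℝ}

theorem continuous_zonal (hF : ContinuousOn F (Set.Icc (-1) 1)) :
    Continuous fun ω : UnitSphere V => F (inner ℝ ξ.1 ω.1) :=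
  hF.comp_continuous (by fun_prop) fun ω => UnitSphere.inner_mem_Icc ξ ω

theorem continuous_zonal_mul (hF : ContinuousOn F (Set.Icc (-1) 1)) :
    Continuous fun ω => (F (inner ℝ ξ.1 ω.1) : ℂ) * f ω :=
  (Complex.continuous_ofReal.comp (continuous_zonal ξ hF)).mul f.continuous

variable [FiniteDimensional ℝ V] [MeasurableSpace V] [BorelSpace V]

/-- The spherical convolution at `ξ` of the zonal kernel with profile `F` and the density `f`. -/
def zonalIntegral (F : ℝ → ℝ) (ξ : UnitSphere V) (f : C(UnitSphere V, ℂ)) : ℂ :=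
  ∫ ω, (F (inner ℝ ξ.1 ω.1) : ℂ) * f ω ∂sphereMeasure V

theorem zonalIntegral_congr (h : ∀ t ∈ Set.Icc (-1 : ℝ) 1, F t = G t) :
    zonalIntegral F ξ f = zonalIntegral G ξ f := by
  simp only [zonalIntegral, h _ (UnitSphere.inner_mem_Icc ξ _)]

theorem zonalIntegral_const_mul (c : ℝ) :
    zonalIntegral (fun t => c * F t) ξ f = c * zonalIntegral F ξ f := by
  simp only [zonalIntegral, Complex.ofReal_mul, mul_assoc, integral_const_mul]

theorem zonalIntegral_add (hF : ContinuousOn F (Set.Icc (-1) 1))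
    (hG : ContinuousOn G (Set.Icc (-1) 1)) :
    zonalIntegral (fun t => F t + G t) ξ f = zonalIntegral F ξ f + zonalIntegral G ξ f := by
  simp only [zonalIntegral, Complex.ofReal_add, add_mul]
  exact integral_add (integrable_sphereMeasure (continuous_zonal_mul ξ f hF))
    (integrable_sphereMeasure (continuous_zonal_mul ξ f hG))

theorem zonalIntegral_one : zonalIntegral F ξ 1 = ∫ ω, F (inner ℝ ξ.1 ω.1) ∂sphereMeasure V := by
  simp [zonalIntegral, integral_complex_ofReal]

theorem hasDerivAt_zonalIntegral {U : Set ℝ} (hU : IsOpen U) {Φ Φ' : ℝ → ℝ → ℝ}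
    (hderiv : ∀ s ∈ U, ∀ t ∈ Set.Icc (-1 : ℝ) 1, HasDerivAt (fun s => Φ s t) (Φ' s t) s)
    (hΦ : ContinuousOn (fun z : ℝ × ℝ => Φ z.1 z.2) (U ×ˢ Set.Icc (-1 : ℝ) 1))
    (hΦ' : ContinuousOn (fun z : ℝ × ℝ => Φ' z.1 z.2) (U ×ˢ Set.Icc (-1 : ℝ) 1))
    {s : ℝ} (hs : s ∈ U) :
    HasDerivAt (fun s => zonalIntegral (Φ s) ξ f) (zonalIntegral (Φ' s) ξ f) s := by
  have hcont : ∀ {Ψ : ℝ → ℝ → ℝ},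
      ContinuousOn (fun z : ℝ × ℝ => Ψ z.1 z.2) (U ×ˢ Set.Icc (-1 : ℝ) 1) →
      ContinuousOn (fun z : ℝ × UnitSphere V => (Ψ z.1 (inner ℝ ξ.1 z.2.1) : ℂ) * f z.2)
        (U ×ˢ Set.univ) := fun hΨ =>
    (Complex.continuous_ofReal.comp_continuousOn (hΨ.comp (f := fun z : ℝ × UnitSphere V =>
      (z.1, inner ℝ ξ.1 z.2.1)) (by fun_prop)
      fun z hz => ⟨hz.1, UnitSphere.inner_mem_Icc ξ z.2⟩)).mul (by fun_prop)
  exact hasDerivAt_integral_of_continuousOn _ hU (hcont hΦ) (hcont hΦ')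
    (fun u hu ω => (hderiv u hu _ (UnitSphere.inner_mem_Icc ξ ω)).ofReal_comp.mul_const _) hs

end ZonalIntegral

section RadialEquation

theorem mul_eq_of_radial_equation (n : ℕ) {f f' f'' : ℝ → ℂ}
    (hf : ∀ s ∈ Set.Ioo (-1 : ℝ) 1, HasDerivAt f (f' s) s)
    (hf' : ∀ s ∈ Set.Ioo (-1 : ℝ) 1, HasDerivAt f' (f'' s) s)
    (heq : ∀ s ∈ Set.Ioo (-1 : ℝ) 1, (s : ℂ) ^ 2 * f'' s + 2 * s * f' s = n * (n + 1) * f s)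
    {s : ℝ} (hs : s ∈ Set.Ioo (0 : ℝ) 1) : s * f' s = n * f s := by
  -- `s ^ (n + 1) (s f' - n f)` is constant and vanishes at the origin.
  have hderiv : ∀ s ∈ Set.Ioo (-1 : ℝ) 1,
      HasDerivAt (fun s : ℝ => (s : ℂ) ^ (n + 1) * (s * f' s - n * f s)) 0 s := fun s hs => by
    have hid : HasDerivAt (fun s : ℝ => (s : ℂ)) 1 s := (hasDerivAt_id s).ofReal_comp
    refine ((hid.pow (n + 1)).mul
      ((hid.mul (hf' s hs)).sub ((hf s hs).const_mul (n : ℂ)))).congr_deriv ?_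
    simp only [Pi.mul_apply, Pi.sub_apply, Pi.pow_apply, Nat.add_sub_cancel, mul_one, one_mul,
      Nat.cast_add, Nat.cast_one]
    linear_combination (s : ℂ) ^ n * heq s hs
  have hconst := isOpen_Ioo.is_const_of_deriv_eq_zero isPreconnected_Ioo
    (fun s hs => (hderiv s hs).differentiableAt.differentiableWithinAt)
    (fun s hs => (hderiv s hs).deriv) ⟨by linarith [hs.1], hs.2⟩
    (show (0 : ℝ) ∈ Set.Ioo (-1 : ℝ) 1 by simp)
  simp only [Complex.ofReal_zero, zero_pow n.succ_ne_zero, zero_mul] at hconst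
  exact sub_eq_zero.1 ((mul_eq_zero.1 hconst).resolve_left
    (pow_ne_zero _ (by exact_mod_cast hs.1.ne')))

theorem exists_eq_pow_mul_of_mul_eq (n : ℕ) {f f' : ℝ → ℂ}
    (hf : ∀ s ∈ Set.Ioo (0 : ℝ) 1, HasDerivAt f (f' s) s)
    (heq : ∀ s ∈ Set.Ioo (0 : ℝ) 1, s * f' s = n * f s) :
    ∃ c : ℂ, ∀ s ∈ Set.Ioo (0 : ℝ) 1, f s = (s : ℂ) ^ n * c := by
  have hderiv : ∀ s ∈ Set.Ioo (0 : ℝ) 1, HasDerivAt (fun s : ℝ => f s / (s : ℂ) ^ n) 0 s :=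
      fun s hs => by
    have hs0 : (s : ℂ) ≠ 0 := by exact_mod_cast hs.1.ne'
    have hid : HasDerivAt (fun s : ℝ => (s : ℂ)) 1 s := (hasDerivAt_id s).ofReal_comp
    refine ((hf s hs).div (hid.pow n) (pow_ne_zero n hs0)).congr_deriv ?_
    refine div_eq_zero_iff.2 (.inl (mul_left_cancel₀ hs0 ?_))
    rcases n with _ | n
    · simpa [hs0] using heq s hs
    · simp only [Pi.pow_apply, Nat.add_sub_cancel]
      linear_combination (s : ℂ) ^ (n + 1) * heq s hs
  refine ⟨f (1 / 2) / ((1 / 2 : ℝ) : ℂ) ^ n, fun s hs => ?_⟩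
  have hs0 : (s : ℂ) ≠ 0 := by exact_mod_cast hs.1.ne'
  have hconst := isOpen_Ioo.is_const_of_deriv_eq_zero isPreconnected_Ioo
    (fun s hs => (hderiv s hs).differentiableAt.differentiableWithinAt)
    (fun s hs => (hderiv s hs).deriv) hs (show (1 / 2 : ℝ) ∈ Set.Ioo (0 : ℝ) 1 by norm_num)
  rw [← hconst]
  field_simp

end RadialEquation

section ZonalPotential

/-- The value at `s ξ` of the potential `x ↦ ∫ f ω / |x - ω|` of the density `f` on the unit
sphere. -/
def zonalPotential (ξ : UnitSphere E3) (f : C(UnitSphere E3, ℂ)) (s : ℝ) : ℂ :=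
  zonalIntegral (invDist s) ξ f

/-- The radial derivative of `zonalPotential`. -/
def zonalPotentialDeriv (ξ : UnitSphere E3) (f : C(UnitSphere E3, ℂ)) (s : ℝ) : ℂ :=
  zonalIntegral (fun t => (t - s) * invDist s t ^ 3) ξ f

/-- The second radial derivative of `zonalPotential`. -/
def zonalPotentialDeriv₂ (ξ : UnitSphere E3) (f : C(UnitSphere E3, ℂ)) (s : ℝ) : ℂ :=
  zonalIntegral (fun t => 3 * (t - s) ^ 2 * invDist s t ^ 5 - invDist s t ^ 3) ξ f

variable {ξ : UnitSphere E3} {f : C(UnitSphere E3, ℂ)} {s : ℝ}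

theorem isOpen_abs_ne_one : IsOpen {s : ℝ | |s| ≠ 1} :=
  isOpen_ne_fun continuous_abs continuous_const

theorem abs_ne_one_of_mem_Ioo (hs : s ∈ Set.Ioo (0 : ℝ) 1) : |s| ≠ 1 := by
  rw [abs_of_pos hs.1]
  exact hs.2.ne

theorem hasDerivAt_zonalPotential (hs : |s| ≠ 1) :
    HasDerivAt (zonalPotential ξ f) (zonalPotentialDeriv ξ f s) s :=
  hasDerivAt_zonalIntegral ξ f isOpen_abs_ne_one
    (fun _ hs _ ht => hasDerivAt_invDist_left (invDist_radicand_pos hs ht))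
    continuousOn_uncurry_invDist
    (ContinuousOn.mul (by fun_prop) (continuousOn_uncurry_invDist.pow 3)) hs

theorem hasDerivAt_zonalPotentialDeriv (hs : |s| ≠ 1) :
    HasDerivAt (zonalPotentialDeriv ξ f) (zonalPotentialDeriv₂ ξ f s) s := by
  have hc := continuousOn_uncurry_invDist
  refine hasDerivAt_zonalIntegral ξ f isOpen_abs_ne_one
    (Φ := fun s t => (t - s) * invDist s t ^ 3)
    (Φ' := fun s t => 3 * (t - s) ^ 2 * invDist s t ^ 5 - invDist s t ^ 3)
    (fun s hs t ht => ?_) (ContinuousOn.mul (by fun_prop) (hc.pow 3))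
    ((ContinuousOn.mul (by fun_prop) (hc.pow 5)).sub (hc.pow 3)) hs
  refine (((hasDerivAt_id s).const_sub t).mul
    ((hasDerivAt_invDist_left (invDist_radicand_pos hs ht)).pow 3)).congr_deriv ?_
  simp only [Pi.pow_apply, neg_mul, one_mul, id_eq, Nat.cast_ofNat, Nat.add_one_sub_one]
  ring

theorem zonalPotential_radial_equation {n : ℕ}
    (hf : HasSphericalLaplacian f fun ω => -(n * (n + 1)) * f ω) (hs : |s| ≠ 1) :
    (s : ℂ) ^ 2 * zonalPotentialDeriv₂ ξ f s + 2 * s * zonalPotentialDeriv ξ f s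
      = n * (n + 1) * zonalPotential ξ f s := by
  have hc := continuousOn_invDist hs
  have hF : ∀ t ∈ Set.Icc (-1 : ℝ) 1, HasDerivAt (invDist s) (s * invDist s t ^ 3) t :=
    fun t ht => hasDerivAt_invDist_right (invDist_radicand_pos hs ht)
  have hF' : ∀ t ∈ Set.Icc (-1 : ℝ) 1,
      HasDerivAt (fun t => s * invDist s t ^ 3) (3 * s ^ 2 * invDist s t ^ 5) t := fun t ht => by
    refine (((hF t ht).pow 3).const_mul s).congr_deriv ?_
    simp only [Nat.cast_ofNat, Nat.add_one_sub_one]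
    ring
  have hself := (hasSphericalLaplacian_zonal hF hF' (by fun_prop) ξ).integral_mul_comm hf
  have hkernel : (s : ℂ) ^ 2 * zonalPotentialDeriv₂ ξ f s + 2 * s * zonalPotentialDeriv ξ f s
      = -zonalIntegral (fun t => (1 - t ^ 2) * (3 * s ^ 2 * invDist s t ^ 5)
          - (Fintype.card (Fin 3) - 1) * t * (s * invDist s t ^ 3)) ξ f := by
    rw [zonalPotentialDeriv₂, zonalPotentialDeriv, ← Complex.ofReal_pow, ← zonalIntegral_const_mul,
      ← Complex.ofReal_ofNat, ← Complex.ofReal_mul, ← zonalIntegral_const_mul,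
      ← zonalIntegral_add ξ f (by fun_prop) (by fun_prop), ← neg_one_mul, ← Complex.ofReal_one,
      ← Complex.ofReal_neg, ← zonalIntegral_const_mul]
    refine zonalIntegral_congr ξ f fun t ht => ?_
    rw [Fintype.card_fin]
    push_cast
    linear_combination
      (-3 * s ^ 2 * invDist s t ^ 2) * invDist_eq_pow_mul (invDist_radicand_pos hs ht)
  rw [hkernel, zonalIntegral, hself, zonalPotential, zonalIntegral, ← integral_neg,
    ← integral_const_mul]
  congr 1 with ω
  ring

theorem exists_zonalPotential_eq {n : ℕ}
    (hf : HasSphericalLaplacian f fun ω => -(n * (n + 1)) * f ω) (ξ : UnitSphere E3) :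
    ∃ c : ℂ, ∀ s ∈ Set.Ioo (0 : ℝ) 1, zonalPotential ξ f s = (s : ℂ) ^ n * c
      ∧ s * zonalPotentialDeriv ξ f s = n * zonalPotential ξ f s := by
  have habs : ∀ s ∈ Set.Ioo (-1 : ℝ) 1, |s| ≠ 1 := fun s hs => (abs_lt.2 hs).ne
  have hmul : ∀ s ∈ Set.Ioo (0 : ℝ) 1, s * zonalPotentialDeriv ξ f s = n * zonalPotential ξ f s :=
    fun s hs => mul_eq_of_radial_equation n
      (fun s hs => hasDerivAt_zonalPotential (habs s hs))
      (fun s hs => hasDerivAt_zonalPotentialDeriv (habs s hs))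
      (fun s hs => zonalPotential_radial_equation hf (habs s hs)) hs
  obtain ⟨c, hc⟩ := exists_eq_pow_mul_of_mul_eq n
    (fun s hs => hasDerivAt_zonalPotential (abs_ne_one_of_mem_Ioo hs)) hmul
  exact ⟨c, fun s hs => ⟨hc s hs, hmul s hs⟩⟩

theorem hasSphericalLaplacian_one :
    HasSphericalLaplacian (1 : C(UnitSphere E3, ℂ))
      fun ω => -((0 : ℕ) * ((0 : ℕ) + 1)) * (1 : C(UnitSphere E3, ℂ)) ω := by
  have h := hasSphericalLaplacian_restrictSphere (p := (1 : MvPolynomial (Fin 3) ℂ)) (n := 0)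
    ⟨isHomogeneous_one _ _,
      polyLaplacian_eq_zero_of_isHomogeneous_of_lt_two (isHomogeneous_one _ _) two_pos⟩
  simpa only [map_one, Nat.cast_zero, zero_mul] using h

theorem zonalPotential_one (hs : s ∈ Set.Ioo (0 : ℝ) 1) :
    zonalPotential ξ 1 s = 4 * Real.pi := by
  obtain ⟨c, hc⟩ := exists_zonalPotential_eq hasSphericalLaplacian_one ξ
  have hzero : zonalPotential ξ 1 0 = 4 * Real.pi := by
    simp [zonalPotential, zonalIntegral, invDist, -Measure.toSphere_real_apply_univ,
      sphereMeasure_real_univ]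
  have hlim : Tendsto (zonalPotential ξ 1) (𝓝[>] 0) (𝓝 (zonalPotential ξ 1 0)) :=
    (hasDerivAt_zonalPotential (by simp)).continuousAt.tendsto.mono_left nhdsWithin_le_nhds
  have hlim' : Tendsto (zonalPotential ξ 1) (𝓝[>] 0) (𝓝 c) := by
    refine tendsto_const_nhds.congr' ?_
    filter_upwards [Ioo_mem_nhdsGT (zero_lt_one (α := ℝ))] with u hu
    rw [(hc u hu).1, pow_zero, one_mul]
  rw [(hc s hs).1, pow_zero, one_mul, ← hzero]
  exact tendsto_nhds_unique hlim' hlim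

theorem integral_invDist (ξ : UnitSphere E3) (hs : s ∈ Set.Ioo (0 : ℝ) 1) :
    ∫ ω, invDist s (inner ℝ ξ.1 ω.1) ∂sphereMeasure E3 = 4 * Real.pi := by
  have h := zonalPotential_one (ξ := ξ) hs
  rw [zonalPotential, zonalIntegral_one] at h
  exact_mod_cast h

end ZonalPotential

section PoissonKernel

/-- The Poisson kernel of the unit ball of `ℝ³` at `s ξ` and `ω`, for unit vectors `ξ` and `ω`
with inner product `t`. -/
def spherePoissonKernel (s t : ℝ) : ℝ := (4 * Real.pi)⁻¹ * ((1 - s ^ 2) * invDist s t ^ 3)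

variable {ξ : UnitSphere E3} {f : C(UnitSphere E3, ℂ)} {s : ℝ}

theorem continuousOn_spherePoissonKernel (hs : |s| ≠ 1) :
    ContinuousOn (spherePoissonKernel s) (Set.Icc (-1) 1) :=
  continuousOn_const.mul (continuousOn_const.mul ((continuousOn_invDist hs).pow 3))

theorem spherePoissonKernel_nonneg (hs : s ∈ Set.Ioo (0 : ℝ) 1) (t : ℝ) :
    0 ≤ spherePoissonKernel s t := by
  have h : 0 ≤ 1 - s ^ 2 := by nlinarith [hs.1, hs.2]
  have := invDist_nonneg s t
  unfold spherePoissonKernel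
  positivity

theorem two_mul_zonalPotentialDeriv_add (hs : |s| ≠ 1) :
    2 * (s * zonalPotentialDeriv ξ f s) + zonalPotential ξ f s
      = 4 * Real.pi * zonalIntegral (spherePoissonKernel s) ξ f := by
  have hc := continuousOn_invDist hs
  have h : 4 * Real.pi * zonalIntegral (spherePoissonKernel s) ξ f = zonalIntegral
      (fun t => 2 * s * ((t - s) * invDist s t ^ 3) + invDist s t) ξ f := by
    rw [← Complex.ofReal_ofNat, ← Complex.ofReal_mul, ← zonalIntegral_const_mul]
    refine zonalIntegral_congr ξ f fun t ht => ?_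
    unfold spherePoissonKernel
    field_simp
    linear_combination -invDist_eq_pow_mul (invDist_radicand_pos hs ht)
  rw [h, zonalIntegral_add ξ f (by fun_prop) hc, zonalIntegral_const_mul, zonalPotential,
    zonalPotentialDeriv]
  push_cast
  ring

theorem integral_spherePoissonKernel (ξ : UnitSphere E3) (hs : s ∈ Set.Ioo (0 : ℝ) 1) :
    ∫ ω, spherePoissonKernel s (inner ℝ ξ.1 ω.1) ∂sphereMeasure E3 = 1 := by
  obtain ⟨c, hc⟩ := exists_zonalPotential_eq hasSphericalLaplacian_one ξ
  have h := two_mul_zonalPotentialDeriv_add (ξ := ξ) (f := 1) (abs_ne_one_of_mem_Ioo hs)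
  rw [(hc s hs).2, zonalPotential_one hs, zonalIntegral_one] at h
  have hpi : (4 * Real.pi : ℂ) ≠ 0 := by simp [Real.pi_ne_zero]
  refine Complex.ofReal_injective (mul_left_cancel₀ hpi ?_)
  rw [← h]
  simp

theorem tendstoUniformlyOn_spherePoissonKernel {u : Set (UnitSphere E3)} (hu : IsOpen u)
    (hξ : ξ ∈ u) : TendstoUniformlyOn
      (fun s (ω : UnitSphere E3) => spherePoissonKernel s (inner ℝ ξ.1 ω.1)) 0 (𝓝[<] 1) uᶜ := by
  obtain ⟨δ, hδ, hball⟩ := Metric.isOpen_iff.1 hu ξ hξ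
  have hlim : Tendsto (fun s : ℝ => (4 * Real.pi)⁻¹ * ((1 - s ^ 2) * (2 * δ⁻¹) ^ 3)) (𝓝[<] 1)
      (𝓝 0) := by
    have hc : Continuous fun s : ℝ => (4 * Real.pi)⁻¹ * ((1 - s ^ 2) * (2 * δ⁻¹) ^ 3) := by
      fun_prop
    simpa using (hc.tendsto 1).mono_left (nhdsWithin_le_nhds (s := Set.Iio 1))
  refine Metric.tendstoUniformlyOn_iff.2 fun ε hε => ?_
  filter_upwards [Ioo_mem_nhdsLT (zero_lt_one (α := ℝ)), hlim.eventually_lt_const hε]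
    with s hs hsε ω hω
  have hdist : δ ≤ ‖ξ.1 - ω.1‖ := by
    rw [← dist_eq_norm, dist_comm]
    exact not_lt.1 fun h => hω (hball h)
  have hne : inner ℝ ξ.1 ω.1 ≠ 1 := fun h => by
    rw [(inner_eq_one_iff_of_norm_eq_one ξ.norm_coe ω.norm_coe).1 h, sub_self, norm_zero] at hdist
    exact hδ.not_ge hdist
  have hIcc := UnitSphere.inner_mem_Icc ξ ω
  have hle : invDist s (inner ℝ ξ.1 ω.1) ≤ 2 * δ⁻¹ := calc
    invDist s (inner ℝ ξ.1 ω.1) ≤ 2 * ‖ξ.1 - ω.1‖⁻¹ :=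
      invDist_one_inner ξ ω ▸ invDist_le_two_mul hs ⟨hIcc.1, hIcc.2.lt_of_ne hne⟩
    _ ≤ 2 * δ⁻¹ := by gcongr
  rw [Pi.zero_apply, dist_zero_left, Real.norm_of_nonneg (spherePoissonKernel_nonneg hs _)]
  refine lt_of_le_of_lt ?_ hsε
  have hnonneg : 0 ≤ 1 - s ^ 2 := by nlinarith [hs.1, hs.2]
  have := invDist_nonneg s (inner ℝ ξ.1 ω.1)
  unfold spherePoissonKernel
  gcongr

theorem tendsto_zonalIntegral_spherePoissonKernel (ξ : UnitSphere E3) (f : C(UnitSphere E3, ℂ)) :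
    Tendsto (fun s => zonalIntegral (spherePoissonKernel s) ξ f) (𝓝[<] 1) (𝓝 (f ξ)) := by
  have hIoo := Ioo_mem_nhdsLT (zero_lt_one (α := ℝ))
  refine (tendsto_integral_peak_smul_of_integrable_of_tendsto (μ := sphereMeasure E3)
    (φ := fun s ω => spherePoissonKernel s (inner ℝ ξ.1 ω.1)) MeasurableSet.univ univ_mem
    (measure_ne_top _ _) ?_ (fun u => tendstoUniformlyOn_spherePoissonKernel) ?_ ?_
    (integrable_sphereMeasure f.continuous) (f.continuous.tendsto ξ)).congr fun s => ?_
  · filter_upwards [hIoo] with s hs ω using spherePoissonKernel_nonneg hs _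
  · refine tendsto_const_nhds.congr' ?_
    filter_upwards [hIoo] with s hs
    rw [Measure.restrict_univ, integral_spherePoissonKernel ξ hs]
  · filter_upwards [hIoo] with s hs
    exact (continuous_zonal ξ (continuousOn_spherePoissonKernel
      (abs_ne_one_of_mem_Ioo hs))).aestronglyMeasurable
  · simp only [zonalIntegral, Complex.real_smul]

end PoissonKernel

section ZonalPotentialValues

variable {n : ℕ} {f : C(UnitSphere E3, ℂ)} {s : ℝ}

theorem zonalPotential_of_lt_one (hf : HasSphericalLaplacian f fun ω => -(n * (n + 1)) * f ω)
    (ξ : UnitSphere E3) (hs : s ∈ Set.Ioo (0 : ℝ) 1) :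
    zonalPotential ξ f s = (s : ℂ) ^ n * (4 * Real.pi / (2 * n + 1) * f ξ) := by
  obtain ⟨c, hc⟩ := exists_zonalPotential_eq hf ξ
  have hlim : Tendsto (fun s : ℝ => (2 * n + 1) * ((s : ℂ) ^ n * c)) (𝓝[<] 1)
      (𝓝 ((2 * n + 1) * (((1 : ℝ) : ℂ) ^ n * c))) :=
    ((by fun_prop : Continuous fun s : ℝ => (2 * n + 1) * ((s : ℂ) ^ n * c)).tendsto 1).mono_left
      nhdsWithin_le_nhds
  have hlim' : Tendsto (fun s : ℝ => (2 * n + 1) * ((s : ℂ) ^ n * c)) (𝓝[<] 1)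
      (𝓝 (4 * Real.pi * f ξ)) := by
    refine ((tendsto_zonalIntegral_spherePoissonKernel ξ f).const_mul (4 * Real.pi : ℂ)).congr' ?_
    filter_upwards [Ioo_mem_nhdsLT (zero_lt_one (α := ℝ))] with u hu
    rw [← two_mul_zonalPotentialDeriv_add (abs_ne_one_of_mem_Ioo hu), (hc u hu).2, (hc u hu).1]
    ring
  have h := tendsto_nhds_unique hlim hlim'
  have hn : (2 * n + 1 : ℂ) ≠ 0 := by exact_mod_cast (2 * n).succ_ne_zero
  rw [Complex.ofReal_one, one_pow, one_mul] at h
  rw [(hc s hs).1, div_mul_eq_mul_div, ← h, mul_div_cancel_left₀ c hn]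

theorem mul_zonalPotentialDeriv_of_lt_one
    (hf : HasSphericalLaplacian f fun ω => -(n * (n + 1)) * f ω)
    (ξ : UnitSphere E3) (hs : s ∈ Set.Ioo (0 : ℝ) 1) :
    s * zonalPotentialDeriv ξ f s = n * (s : ℂ) ^ n * (4 * Real.pi / (2 * n + 1) * f ξ) := by
  obtain ⟨c, hc⟩ := exists_zonalPotential_eq hf ξ
  rw [(hc s hs).2, zonalPotential_of_lt_one hf ξ hs, mul_assoc]

theorem zonalPotential_inv (ξ : UnitSphere E3) (f : C(UnitSphere E3, ℂ)) (hs : 0 < s) :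
    zonalPotential ξ f s = (s : ℂ)⁻¹ * zonalPotential ξ f s⁻¹ := by
  rw [zonalPotential, zonalPotential, ← Complex.ofReal_inv, ← zonalIntegral_const_mul]
  exact zonalIntegral_congr ξ f fun t _ => invDist_inv hs t

theorem zonalPotential_of_one_lt (hf : HasSphericalLaplacian f fun ω => -(n * (n + 1)) * f ω)
    (ξ : UnitSphere E3) (hs : 1 < s) :
    zonalPotential ξ f s = ((s : ℂ) ^ (n + 1))⁻¹ * (4 * Real.pi / (2 * n + 1) * f ξ) := by
  have hs0 : 0 < s := zero_lt_one.trans hs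
  rw [zonalPotential_inv ξ f hs0,
    zonalPotential_of_lt_one hf ξ ⟨inv_pos.2 hs0, inv_lt_one_of_one_lt₀ hs⟩, Complex.ofReal_inv,
    pow_succ, mul_inv, inv_pow]
  ring

theorem zonalPotentialDeriv_of_one_lt
    (hf : HasSphericalLaplacian f fun ω => -(n * (n + 1)) * f ω)
    (ξ : UnitSphere E3) (hs : 1 < s) :
    zonalPotentialDeriv ξ f s
      = -(n + 1) * ((s : ℂ) ^ (n + 2))⁻¹ * (4 * Real.pi / (2 * n + 1) * f ξ) := by
  have hs0 : 0 < s := zero_lt_one.trans hs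
  have hsC : (s : ℂ) ≠ 0 := by exact_mod_cast hs0.ne'
  have hid : HasDerivAt (fun s : ℝ => (s : ℂ)) 1 s := (hasDerivAt_id s).ofReal_comp
  have hderiv : HasDerivAt (zonalPotential ξ f) _ s :=
    (((hid.pow (n + 1)).inv (pow_ne_zero _ hsC)).mul_const
      (4 * Real.pi / (2 * n + 1) * f ξ)).congr_of_eventuallyEq (by
        filter_upwards [lt_mem_nhds hs] with u hu using zonalPotential_of_one_lt hf ξ hu)
  have habs : |s| ≠ 1 := by
    rw [abs_of_pos hs0]
    exact hs.ne'
  rw [(hasDerivAt_zonalPotential habs).unique hderiv]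
  simp only [Pi.pow_apply, Nat.add_sub_cancel]
  push_cast
  field_simp
  ring

theorem tendsto_invDist_one {u : ℕ → ℝ} (hu : Tendsto u atTop (𝓝 1)) {t : ℝ} (ht : t < 1) :
    Tendsto (fun k => invDist (u k) t) atTop (𝓝 (invDist 1 t)) :=
  (hasDerivAt_invDist_left (by linarith)).continuousAt.tendsto.comp hu

theorem exists_seq_tendsto_one :
    ∃ u : ℕ → ℝ, (∀ k, u k ∈ Set.Ioo (0 : ℝ) 1) ∧ Tendsto u atTop (𝓝 1) := by
  obtain ⟨u, -, hu, hlim⟩ := exists_seq_strictMono_tendsto' (zero_lt_one (α := ℝ))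
  exact ⟨u, hu, hlim⟩

theorem ae_inner_lt_one_E3 (ξ : UnitSphere E3) :
    ∀ᵐ ω ∂sphereMeasure E3, inner ℝ ξ.1 ω.1 < 1 :=
  ae_inner_lt_one (by simp) ξ

theorem integrable_invDist_one (ξ : UnitSphere E3) :
    Integrable (fun ω => invDist 1 (inner ℝ ξ.1 ω.1)) (sphereMeasure E3) := by
  obtain ⟨u, hu, hlim⟩ := exists_seq_tendsto_one
  have hcont : ∀ k, Continuous fun ω : UnitSphere E3 => invDist (u k) (inner ℝ ξ.1 ω.1) :=
    fun k => continuous_zonal ξ (continuousOn_invDist (abs_ne_one_of_mem_Ioo (hu k)))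
  have hae : ∀ᵐ ω ∂sphereMeasure E3, Tendsto (fun k => invDist (u k) (inner ℝ ξ.1 ω.1)) atTop
      (𝓝 (invDist 1 (inner ℝ ξ.1 ω.1))) := by
    filter_upwards [ae_inner_lt_one_E3 ξ] with ω hω using tendsto_invDist_one hlim hω
  have hmass : ∀ k, ∫⁻ ω, ‖invDist (u k) (inner ℝ ξ.1 ω.1)‖ₑ ∂sphereMeasure E3
      = ENNReal.ofReal (4 * Real.pi) := fun k => by
    rw [← integral_invDist ξ (hu k), ofReal_integral_eq_lintegral_ofReal
      (integrable_sphereMeasure (hcont k)) (.of_forall fun ω => invDist_nonneg _ _)]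
    exact lintegral_congr fun ω => Real.enorm_eq_ofReal (invDist_nonneg _ _)
  have hfatou := Lp.eLpNorm_lim_le_liminf_eLpNorm (p := 1)
    (fun k => (hcont k).aestronglyMeasurable) _ hae
  simp only [eLpNorm_one_eq_lintegral_enorm, hmass, liminf_const] at hfatou
  exact ⟨aestronglyMeasurable_of_tendsto_ae _ (fun k => (hcont k).aestronglyMeasurable) hae,
    hfatou.trans_lt ENNReal.ofReal_lt_top⟩

theorem zonalPotential_at_one (hf : HasSphericalLaplacian f fun ω => -(n * (n + 1)) * f ω)
    (ξ : UnitSphere E3) : zonalPotential ξ f 1 = 4 * Real.pi / (2 * n + 1) * f ξ := by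
  obtain ⟨u, hu, hlim⟩ := exists_seq_tendsto_one
  have hdom : Tendsto (fun k => zonalPotential ξ f (u k)) atTop (𝓝 (zonalPotential ξ f 1)) := by
    refine tendsto_integral_of_dominated_convergence
      (fun ω => 2 * invDist 1 (inner ℝ ξ.1 ω.1) * ‖f‖)
      (fun k => (continuous_zonal_mul ξ f (continuousOn_invDist
        (abs_ne_one_of_mem_Ioo (hu k)))).aestronglyMeasurable)
      (((integrable_invDist_one ξ).const_mul 2).mul_const _) (fun k => ?_) ?_
    · filter_upwards [ae_inner_lt_one_E3 ξ] with ω hω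
      rw [norm_mul, Complex.norm_real, Real.norm_of_nonneg (invDist_nonneg _ _)]
      exact mul_le_mul (invDist_le_two_mul (hu k) ⟨(UnitSphere.inner_mem_Icc ξ ω).1, hω⟩)
        (f.norm_coe_le_norm ω) (norm_nonneg _) (mul_nonneg zero_le_two (invDist_nonneg _ _))
    · filter_upwards [ae_inner_lt_one_E3 ξ] with ω hω
      exact ((Complex.continuous_ofReal.tendsto _).comp (tendsto_invDist_one hlim hω)).mul_const _
  have hpow : Tendsto (fun k => zonalPotential ξ f (u k)) atTop
      (𝓝 (((1 : ℝ) : ℂ) ^ n * (4 * Real.pi / (2 * n + 1) * f ξ))) := by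
    simp only [zonalPotential_of_lt_one hf ξ (hu _)]
    exact (((Complex.continuous_ofReal.tendsto _).comp hlim).pow n).mul_const _
  simpa using tendsto_nhds_unique hdom hpow

end ZonalPotentialValues

section SurfaceMeasure

variable {r : ℝ}

theorem measurableEmbedding_smul_sphere (hr : 0 < r) :
    MeasurableEmbedding fun ω : UnitSphere E3 => r • ω.1 :=
  (Homeomorph.smulOfNeZero r hr.ne').measurableEmbedding.comp
    (.subtype_coe isClosed_sphere.measurableSet)

theorem integral_surfaceMeasure {F : Type*} [NormedAddCommGroup F] [NormedSpace ℝ F] (hr : 0 < r)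
    (g : E3 → F) :
    ∫ y, g y ∂surfaceMeasure r = r ^ 2 • ∫ ω : UnitSphere E3, g (r • ω.1) ∂sphereMeasure E3 := by
  rw [surfaceMeasure, integral_smul_measure, (measurableEmbedding_smul_sphere hr).integral_map,
    ENNReal.toReal_ofReal (sq_nonneg r)]

theorem lintegral_surfaceMeasure (hr : 0 < r) (g : E3 → ENNReal) :
    ∫⁻ y, g y ∂surfaceMeasure r
      = ENNReal.ofReal (r ^ 2) * ∫⁻ ω : UnitSphere E3, g (r • ω.1) ∂sphereMeasure E3 := by
  rw [surfaceMeasure, lintegral_smul_measure, (measurableEmbedding_smul_sphere hr).lintegral_map,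
    smul_eq_mul]

theorem ae_surfaceMeasure_iff (hr : 0 < r) {P : E3 → Prop} :
    (∀ᵐ y ∂surfaceMeasure r, P y) ↔ ∀ᵐ ω : UnitSphere E3 ∂sphereMeasure E3, P (r • ω.1) := by
  rw [surfaceMeasure, Measure.ae_ennreal_smul_measure_eq (by simpa using hr.ne'),
    (measurableEmbedding_smul_sphere hr).ae_map_iff]

theorem norm_smul_unitSphere (hr : 0 ≤ r) (ω : UnitSphere E3) : ‖r • ω.1‖ = r := by
  rw [norm_smul, ω.norm_coe, mul_one, Real.norm_of_nonneg hr]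

theorem ae_norm_eq (hr : 0 < r) : ∀ᵐ y ∂surfaceMeasure r, ‖y‖ = r :=
  (ae_surfaceMeasure_iff hr).2 (.of_forall (norm_smul_unitSphere hr.le))

theorem exists_eq_smul_unitSphere (hr : 0 < r) {x : E3} (hx : ‖x‖ = r) :
    ∃ ξ : UnitSphere E3, x = r • ξ.1 :=
  ⟨⟨r⁻¹ • x, by simp [norm_smul, hx, abs_of_pos hr, hr.ne']⟩, (smul_inv_smul₀ hr.ne' x).symm⟩

theorem unitVec_smul (hr : 0 < r) (ω : UnitSphere E3) : unitVec (r • ω.1) = ω.1 := by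
  rw [unitVec, norm_smul_unitSphere hr.le, inv_smul_smul₀ hr.ne']

theorem angular_smul (hr : 0 < r) (p : MvPolynomial (Fin 3) ℂ) (ω : UnitSphere E3) :
    angular p (r • ω.1) = restrictSphere p ω := by
  rw [angular, unitVec_smul hr, restrictSphere_eq_eval]

end SurfaceMeasure

section FundSol

theorem hasFDerivAt_fundSol {z : E3} (hz : z ≠ 0) :
    HasFDerivAt fundSol ((4 * Real.pi * ‖z‖ ^ 3)⁻¹ • innerSL ℝ z) z := by
  have hz' : 0 < ‖z‖ := norm_pos_iff.2 hz
  have hsq : HasFDerivAt (fun x : E3 => ‖x‖ ^ 2) (2 • innerSL ℝ z) z :=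
    (hasStrictFDerivAt_norm_sq z).hasFDerivAt
  have houter := ((hasDerivAt_inv_sqrt (hasDerivAt_id (‖z‖ ^ 2)) (pow_pos hz' 2)).const_mul
    (4 * Real.pi)⁻¹).neg
  have heq : fundSol = (fun q : ℝ => -((4 * Real.pi)⁻¹ * (√q)⁻¹)) ∘ fun x : E3 => ‖x‖ ^ 2 := by
    funext x
    simp only [fundSol, Function.comp, Real.sqrt_sq (norm_nonneg x), one_div, mul_inv]
  rw [heq]
  refine (houter.comp_hasFDerivAt z hsq).congr_fderiv ?_
  ext v
  simp only [id_eq, Real.sqrt_sq hz'.le, smul_apply, innerSL_apply_apply, smul_eq_mul]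
  field_simp
  simp

-- At `z = 0` both sides vanish, the left one because `fundSol` is even.
theorem fderiv_fundSol (z : E3) :
    fderiv ℝ fundSol z = (4 * Real.pi * ‖z‖ ^ 3)⁻¹ • innerSL ℝ z := by
  rcases eq_or_ne z 0 with rfl | hz
  · have heven : fundSol ∘ ContinuousLinearEquiv.neg ℝ (M := E3) = fundSol := by
      funext x
      simp [fundSol]
    have h := (ContinuousLinearEquiv.neg ℝ (M := E3)).comp_right_fderiv (f := fundSol) (x := 0)
    rw [heven, map_zero] at h
    rw [map_zero, smul_zero]
    ext v
    have hv : fderiv ℝ fundSol 0 v = -fderiv ℝ fundSol 0 v := by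
      simpa using DFunLike.congr_fun h v
    simpa using self_eq_neg.1 hv
  · exact (hasFDerivAt_fundSol hz).fderiv

theorem norm_fderiv_fundSol_le {z : E3} {d : ℝ} (hd : 0 < d) (hz : d ≤ ‖z‖) :
    ‖fderiv ℝ fundSol z‖ ≤ (4 * Real.pi * d ^ 2)⁻¹ := by
  have hz' : 0 < ‖z‖ := hd.trans_le hz
  calc ‖fderiv ℝ fundSol z‖ = (4 * Real.pi * ‖z‖ ^ 2)⁻¹ := by
        rw [fderiv_fundSol, norm_smul, innerSL_apply_norm, Real.norm_of_nonneg (by positivity)]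
        field_simp
    _ ≤ (4 * Real.pi * d ^ 2)⁻¹ := by gcongr

end FundSol

section NPKernel

/-- The derivative at `x`, in the direction of the outward normal `x̂`, of the fundamental solution
with pole `y`: the kernel both of `neumannPoincareStar` and of the normal derivative of a single
layer potential on another sphere. -/
def npKernel (x y : E3) : ℝ := fderiv ℝ fundSol (x - y) (unitVec x)

theorem npKernel_eq (x y : E3) :
    npKernel x y = (4 * Real.pi * ‖x - y‖ ^ 3)⁻¹ * inner ℝ (x - y) (unitVec x) := by
  rw [npKernel, fderiv_fundSol, smul_apply, innerSL_apply_apply, smul_eq_mul]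

theorem measurable_npKernel : Measurable (Function.uncurry npKernel) := by
  have hsub : Measurable fun z : E3 × E3 => z.1 - z.2 := by fun_prop
  have hunit : Measurable fun z : E3 × E3 => unitVec z.1 := measurable_unitVec.comp measurable_fst
  simp only [Function.uncurry_def, npKernel_eq]
  exact ((hsub.norm.pow_const 3).const_mul _).inv.mul (hsub.inner hunit)

theorem norm_npKernel_le {x y : E3} {d : ℝ} (hd : 0 < d) (h : d ≤ ‖x - y‖) :
    ‖npKernel x y‖ ≤ (4 * Real.pi * d ^ 2)⁻¹ :=
  ((fderiv ℝ fundSol (x - y)).le_of_opNorm_le_of_le (norm_fderiv_fundSol_le hd h)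
    (norm_unitVec_le x)).trans_eq (mul_one _)

variable {r ρ : ℝ}

theorem norm_smul_sub_smul_inv (hr : 0 < r) (ξ ω : UnitSphere E3) :
    ‖ρ • ξ.1 - r • ω.1‖⁻¹ = r⁻¹ * invDist (ρ / r) (inner ℝ ξ.1 ω.1) := by
  have hsq : ‖ρ • ξ.1 - r • ω.1‖ ^ 2
      = r ^ 2 * (1 + (ρ / r) ^ 2 - 2 * (ρ / r) * inner ℝ ξ.1 ω.1) := by
    rw [norm_sub_sq_real, norm_smul, norm_smul, ξ.norm_coe, ω.norm_coe, real_inner_smul_left,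
      real_inner_smul_right, mul_one, mul_one, Real.norm_eq_abs, Real.norm_eq_abs, sq_abs, sq_abs]
    field_simp
    ring
  rw [invDist, ← mul_inv, ← Real.sqrt_sq (norm_nonneg (_ - _)), hsq, Real.sqrt_mul (sq_nonneg r),
    Real.sqrt_sq hr.le]

theorem npKernel_smul (hr : 0 < r) (hρ : 0 < ρ) (ξ ω : UnitSphere E3) :
    npKernel (ρ • ξ.1) (r • ω.1) = (4 * Real.pi * r ^ 2)⁻¹
      * ((ρ / r - inner ℝ ξ.1 ω.1) * invDist (ρ / r) (inner ℝ ξ.1 ω.1) ^ 3) := by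
  rw [npKernel_eq, unitVec_smul hρ, inner_sub_left, real_inner_smul_left, real_inner_smul_left,
    real_inner_self_eq_norm_sq, ξ.norm_coe, mul_inv, ← inv_pow, norm_smul_sub_smul_inv hr,
    real_inner_comm]
  field_simp

/-- On a single sphere the normal component of `x - y` is proportional to `|x - y| ^ 2`, so that
the kernel is only weakly singular. -/
theorem npKernel_smul_self (hr : 0 < r) (ξ ω : UnitSphere E3) :
    npKernel (r • ξ.1) (r • ω.1)
      = (8 * Real.pi * r ^ 2)⁻¹ * invDist 1 (inner ℝ ξ.1 ω.1) := by
  rw [npKernel_smul hr hr, div_self hr.ne']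
  rcases (UnitSphere.inner_mem_Icc ξ ω).2.eq_or_lt with h | h
  · norm_num [h, invDist]
  · have hcube := invDist_eq_pow_mul (s := 1) (t := inner ℝ ξ.1 ω.1) (by linarith)
    rw [show (8 * Real.pi * r ^ 2)⁻¹ = (4 * Real.pi * r ^ 2)⁻¹ / 2 by field_simp; norm_num]
    linear_combination (-(4 * Real.pi * r ^ 2)⁻¹ / 2) * hcube

theorem integral_npKernel_angular (hr : 0 < r) (hρ : 0 < ρ) (p : MvPolynomial (Fin 3) ℂ)
    (ξ : UnitSphere E3) :
    ∫ y, npKernel (ρ • ξ.1) y • angular p y ∂surfaceMeasure r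
      = -(1 / (4 * Real.pi)) * zonalPotentialDeriv ξ (restrictSphere p) (ρ / r) := by
  rw [integral_surfaceMeasure hr, zonalPotentialDeriv, zonalIntegral, ← integral_smul,
    ← integral_const_mul]
  refine integral_congr_ae (.of_forall fun ω => ?_)
  have hrC : (r : ℂ) ≠ 0 := mod_cast hr.ne'
  have hπ : (Real.pi : ℂ) ≠ 0 := mod_cast Real.pi_ne_zero
  simp only [npKernel_smul hr hρ, angular_smul hr, Complex.real_smul]
  push_cast
  field_simp
  ring

theorem integral_npKernel_angular_self (hr : 0 < r) (p : MvPolynomial (Fin 3) ℂ)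
    (ξ : UnitSphere E3) :
    ∫ y, npKernel (r • ξ.1) y • angular p y ∂surfaceMeasure r
      = 1 / (8 * Real.pi) * zonalPotential ξ (restrictSphere p) 1 := by
  rw [integral_surfaceMeasure hr, zonalPotential, zonalIntegral, ← integral_smul,
    ← integral_const_mul]
  refine integral_congr_ae (.of_forall fun ω => ?_)
  have hrC : (r : ℂ) ≠ 0 := mod_cast hr.ne'
  have hπ : (Real.pi : ℂ) ≠ 0 := mod_cast Real.pi_ne_zero
  simp only [npKernel_smul_self hr, angular_smul hr, Complex.real_smul]
  push_cast
  field_simp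

end NPKernel

section SphericalHarmonicEigenvalues

variable {r : ℝ} {n : ℕ} {p : MvPolynomial (Fin 3) ℂ} {x : E3}

theorem hasSphericalLaplacian_restrictSphere_E3 (hp : p ∈ harmonicSubmodule (Fin 3) ℂ n) :
    HasSphericalLaplacian (restrictSphere p) fun ω => -(n * (n + 1)) * restrictSphere p ω := by
  convert hasSphericalLaplacian_restrictSphere hp using 4
  rw [Fintype.card_fin]
  push_cast
  ring

theorem neumannPoincareStar_angular (hr : 0 < r) (hp : p ∈ harmonicSubmodule (Fin 3) ℂ n)
    (hx : ‖x‖ = r) :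
    neumannPoincareStar r (angular p) x = 1 / (2 * (2 * n + 1)) * angular p x := by
  obtain ⟨ξ, rfl⟩ := exists_eq_smul_unitSphere hr hx
  refine (integral_npKernel_angular_self hr p ξ).trans ?_
  rw [zonalPotential_at_one (hasSphericalLaplacian_restrictSphere_E3 hp), angular_smul hr]
  have hπ : (Real.pi : ℂ) ≠ 0 := mod_cast Real.pi_ne_zero
  field_simp
  norm_num

theorem integral_npKernel_angular_of_norm_lt (hr : 0 < r)
    (hp : p ∈ harmonicSubmodule (Fin 3) ℂ n) (hx0 : x ≠ 0) (hx : ‖x‖ < r) :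
    ∫ y, npKernel x y • angular p y ∂surfaceMeasure r
      = -(n / (2 * n + 1) * (‖x‖ / r) ^ (n - 1)) * angular p x := by
  have hρ := norm_pos_iff.2 hx0
  generalize hxρ : ‖x‖ = ρ at hx hρ ⊢
  obtain ⟨ξ, rfl⟩ := exists_eq_smul_unitSphere hρ hxρ
  have hs : ρ / r ∈ Set.Ioo (0 : ℝ) 1 := ⟨div_pos hρ hr, (div_lt_one hr).2 hx⟩
  have hs0 : ((ρ / r : ℝ) : ℂ) ≠ 0 := mod_cast hs.1.ne'
  have hderiv : zonalPotentialDeriv ξ (restrictSphere p) (ρ / r)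
      = n * ((ρ / r : ℝ) : ℂ) ^ (n - 1) * (4 * Real.pi / (2 * n + 1) * restrictSphere p ξ) := by
    rw [← mul_right_inj' hs0,
      mul_zonalPotentialDeriv_of_lt_one (hasSphericalLaplacian_restrictSphere_E3 hp) ξ hs]
    cases n with
    | zero => simp
    | succ n => rw [Nat.add_sub_cancel]; ring
  rw [integral_npKernel_angular hr hρ, angular_smul hρ, hderiv]
  have hπ : (Real.pi : ℂ) ≠ 0 := mod_cast Real.pi_ne_zero
  push_cast
  field_simp

theorem integral_npKernel_angular_of_lt_norm (hr : 0 < r)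
    (hp : p ∈ harmonicSubmodule (Fin 3) ℂ n) (hx : r < ‖x‖) :
    ∫ y, npKernel x y • angular p y ∂surfaceMeasure r
      = (n + 1) / (2 * n + 1) * (r / ‖x‖) ^ (n + 2) * angular p x := by
  have hρ := hr.trans hx
  generalize hxρ : ‖x‖ = ρ at hx hρ ⊢
  obtain ⟨ξ, rfl⟩ := exists_eq_smul_unitSphere hρ hxρ
  rw [integral_npKernel_angular hr hρ, angular_smul hρ, zonalPotentialDeriv_of_one_lt
    (hasSphericalLaplacian_restrictSphere_E3 hp) ξ ((one_lt_div hr).2 hx)]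
  have hπ : (Real.pi : ℂ) ≠ 0 := mod_cast Real.pi_ne_zero
  push_cast
  rw [← inv_pow, inv_div]
  field_simp

end SphericalHarmonicEigenvalues

section SchurTest

variable {X Z : Type*} [MeasurableSpace X] [MeasurableSpace Z] {μ : Measure X} {ν : Measure Z}

theorem sq_lintegral_mul_le {f g : Z → ENNReal} (hf : AEMeasurable f ν) (hg : AEMeasurable g ν) :
    (∫⁻ y, f y * g y ∂ν) ^ 2 ≤ (∫⁻ y, f y ∂ν) * ∫⁻ y, f y * g y ^ 2 ∂ν := by
  have hsqrt : ∀ a : ENNReal, a ^ (1 / 2 : ℝ) * a ^ (1 / 2 : ℝ) = a := fun a => by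
    rw [← ENNReal.rpow_add_of_nonneg _ _ (by norm_num) (by norm_num)]
    norm_num
  have h := ENNReal.lintegral_mul_le_Lp_mul_Lq ν Real.HolderConjugate.two_two
    (hf.pow_const (1 / 2 : ℝ)) ((hf.pow_const (1 / 2 : ℝ)).mul hg)
  simp only [Pi.mul_apply, ← mul_assoc, hsqrt, ENNReal.rpow_two, mul_pow, pow_two (_ ^ (1 / 2 : ℝ))]
    at h
  calc (∫⁻ y, f y * g y ∂ν) ^ 2
      ≤ ((∫⁻ y, f y ∂ν) ^ (1 / 2 : ℝ) * (∫⁻ y, f y * g y ^ 2 ∂ν) ^ (1 / 2 : ℝ)) ^ 2 := by gcongr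
    _ = (∫⁻ y, f y ∂ν) * ∫⁻ y, f y * g y ^ 2 ∂ν := by
        rw [mul_pow, pow_two, pow_two, hsqrt, hsqrt]

theorem eLpNorm_two_sq {F : Type*} [NormedAddCommGroup F] (f : X → F) :
    eLpNorm f 2 μ ^ 2 = ∫⁻ x, ‖f x‖ₑ ^ 2 ∂μ := by
  have h := eLpNorm_nnreal_pow_eq_lintegral (μ := μ) (f := f) (p := 2) two_ne_zero
  simpa only [NNReal.coe_ofNat, ENNReal.coe_ofNat, ENNReal.rpow_two] using h

/-- The kernel `k` is measurable and its marginals are bounded by `C`, as in Schur's test for the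
boundedness in `L²` of the integral operator with kernel `k`. -/
structure IsSchurKernel (k : X → Z → ℝ) (μ : Measure X) (ν : Measure Z) (C : NNReal) : Prop where
  measurable : Measurable (Function.uncurry k)
  lintegral_right_le : ∀ᵐ x ∂μ, ∫⁻ y, ‖k x y‖ₑ ∂ν ≤ C
  lintegral_left_le : ∀ᵐ y ∂ν, ∫⁻ x, ‖k x y‖ₑ ∂μ ≤ C

namespace IsSchurKernel

theorem of_ae_bound [IsFiniteMeasure μ] [IsFiniteMeasure ν] {k : X → Z → ℝ} {B : NNReal}
    (hk : Measurable (Function.uncurry k)) (hB : ∀ᵐ x ∂μ, ∀ᵐ y ∂ν, ‖k x y‖ₑ ≤ B) :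
    IsSchurKernel k μ ν (B * max (measureUnivNNReal ν) (measureUnivNNReal μ)) where
  measurable := hk
  lintegral_right_le := by
    filter_upwards [hB] with x hx
    calc ∫⁻ y, ‖k x y‖ₑ ∂ν ≤ ∫⁻ _, B ∂ν := lintegral_mono_ae hx
      _ ≤ _ := by
        rw [lintegral_const, ← coe_measureUnivNNReal]
        exact_mod_cast mul_le_mul_right (le_max_left _ _) B
  lintegral_left_le := by
    have hB' := (Measure.ae_ae_comm (p := fun x y => ‖k x y‖ₑ ≤ B)
      (measurableSet_le hk.enorm measurable_const)).1 hB
    filter_upwards [hB'] with y hy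
    calc ∫⁻ x, ‖k x y‖ₑ ∂μ ≤ ∫⁻ _, B ∂μ := lintegral_mono_ae hy
      _ ≤ _ := by
        rw [lintegral_const, ← coe_measureUnivNNReal]
        exact_mod_cast mul_le_mul_right (le_max_right _ _) B

variable {k : X → Z → ℝ} {C : NNReal} {F : Type*} [NormedAddCommGroup F] [NormedSpace ℝ F]

theorem aestronglyMeasurable_smul (hk : IsSchurKernel k μ ν C) (φ : Lp F 2 ν) :
    AEStronglyMeasurable (fun z : X × Z => k z.1 z.2 • φ z.2) (μ.prod ν) :=
  hk.measurable.aestronglyMeasurable.smul (Lp.aestronglyMeasurable φ).comp_snd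

variable [SFinite μ] [SFinite ν]

theorem lintegral_sq_le (hk : IsSchurKernel k μ ν C) {g : Z → ENNReal} (hg : AEMeasurable g ν) :
    ∫⁻ x, (∫⁻ y, ‖k x y‖ₑ * g y ∂ν) ^ 2 ∂μ ≤ C ^ 2 * ∫⁻ y, g y ^ 2 ∂ν := by
  have hkx : ∀ x, Measurable fun y => ‖k x y‖ₑ := fun x =>
    (hk.measurable.comp measurable_prodMk_left).enorm
  have hky : ∀ y, Measurable fun x => ‖k x y‖ₑ := fun y =>
    (hk.measurable.comp measurable_prodMk_right).enorm
  have hm : AEMeasurable (fun z : X × Z => ‖k z.1 z.2‖ₑ * g z.2 ^ 2) (μ.prod ν) :=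
    hk.measurable.enorm.aemeasurable.mul (hg.comp_snd.pow_const 2)
  calc ∫⁻ x, (∫⁻ y, ‖k x y‖ₑ * g y ∂ν) ^ 2 ∂μ
      ≤ ∫⁻ x, C * ∫⁻ y, ‖k x y‖ₑ * g y ^ 2 ∂ν ∂μ := by
        refine lintegral_mono_ae ?_
        filter_upwards [hk.lintegral_right_le] with x hx
        exact (sq_lintegral_mul_le (hkx x).aemeasurable hg).trans (by gcongr)
    _ = C * ∫⁻ y, (∫⁻ x, ‖k x y‖ₑ ∂μ) * g y ^ 2 ∂ν := by
        rw [lintegral_const_mul'' _ hm.lintegral_prod_right', lintegral_lintegral_swap hm]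
        simp only [lintegral_mul_const _ (hky _)]
    _ ≤ C * ∫⁻ y, C * g y ^ 2 ∂ν := by
        gcongr 1
        refine lintegral_mono_ae ?_
        filter_upwards [hk.lintegral_left_le] with y hy
        gcongr
    _ = C ^ 2 * ∫⁻ y, g y ^ 2 ∂ν := by
        rw [lintegral_const_mul'' _ (hg.pow_const 2), sq, mul_assoc]

theorem lintegral_sq_le_eLpNorm (hk : IsSchurKernel k μ ν C) (φ : Lp F 2 ν) :
    ∫⁻ x, (∫⁻ y, ‖k x y • φ y‖ₑ ∂ν) ^ 2 ∂μ ≤ (C * eLpNorm φ 2 ν) ^ 2 := by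
  simp only [enorm_smul, mul_pow, eLpNorm_two_sq]
  exact hk.lintegral_sq_le (Lp.aestronglyMeasurable φ).enorm



theorem ae_integrable (hk : IsSchurKernel k μ ν C) (φ : Lp F 2 ν) :
    ∀ᵐ x ∂μ, Integrable (fun y => k x y • φ y) ν := by
  have hfin : ∀ᵐ x ∂μ, (∫⁻ y, ‖k x y • φ y‖ₑ ∂ν) ^ 2 < ⊤ :=
    ae_lt_top' ((hk.aestronglyMeasurable_smul φ).enorm.lintegral_prod_right'.pow_const 2)
      (ne_top_of_le_ne_top (ENNReal.pow_ne_top (ENNReal.mul_ne_top ENNReal.coe_ne_top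
        (Lp.eLpNorm_ne_top φ))) (hk.lintegral_sq_le_eLpNorm φ))
  filter_upwards [hfin] with x hx
  exact ⟨(hk.measurable.comp measurable_prodMk_left).aestronglyMeasurable.smul
    (Lp.aestronglyMeasurable φ), (ENNReal.pow_lt_top_iff.1 hx).resolve_right two_ne_zero⟩

theorem eLpNorm_integral_le (hk : IsSchurKernel k μ ν C) (φ : Lp F 2 ν) :
    eLpNorm (fun x => ∫ y, k x y • φ y ∂ν) 2 μ ≤ C * eLpNorm φ 2 ν := by
  rw [← ENNReal.pow_le_pow_left_iff two_ne_zero, eLpNorm_two_sq]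
  refine (lintegral_mono fun x => ?_).trans (hk.lintegral_sq_le_eLpNorm φ)
  gcongr
  exact enorm_integral_le_lintegral_enorm _

theorem memLp_integral (hk : IsSchurKernel k μ ν C) (φ : Lp F 2 ν) :
    MemLp (fun x => ∫ y, k x y • φ y ∂ν) 2 μ :=
  ⟨(hk.aestronglyMeasurable_smul φ).integral_prod_right', (hk.eLpNorm_integral_le φ).trans_lt
    (ENNReal.mul_lt_top ENNReal.coe_lt_top (Lp.eLpNorm_lt_top φ))⟩

theorem memLp_integral_toLp_add (hk : IsSchurKernel k μ ν C) (φ ψ : Lp F 2 ν) :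
    (hk.memLp_integral (φ + ψ)).toLp = (hk.memLp_integral φ).toLp + (hk.memLp_integral ψ).toLp := by
  rw [← MemLp.toLp_add, MemLp.toLp_eq_toLp_iff]
  filter_upwards [hk.ae_integrable φ, hk.ae_integrable ψ] with x hφ hψ
  rw [Pi.add_apply, ← integral_add hφ hψ]
  refine integral_congr_ae ?_
  filter_upwards [Lp.coeFn_add φ ψ] with y hy
  rw [hy, Pi.add_apply, smul_add]

variable {𝕜 : Type*} [NontriviallyNormedField 𝕜] [NormedSpace 𝕜 F] [SMulCommClass ℝ 𝕜 F]

theorem memLp_integral_toLp_smul (hk : IsSchurKernel k μ ν C) (c : 𝕜) (φ : Lp F 2 ν) :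
    (hk.memLp_integral (c • φ)).toLp = c • (hk.memLp_integral φ).toLp := by
  rw [← MemLp.toLp_const_smul, MemLp.toLp_eq_toLp_iff]
  refine .of_forall fun x => ?_
  rw [Pi.smul_apply, ← integral_smul]
  refine integral_congr_ae ?_
  filter_upwards [Lp.coeFn_smul c φ] with y hy
  rw [hy, Pi.smul_apply, smul_comm]

/-- The integral operator with kernel `k`, as a bounded operator on `L²`. -/
def toLp (hk : IsSchurKernel k μ ν C) : Lp F 2 ν →L[𝕜] Lp F 2 μ :=
  LinearMap.mkContinuous
    { toFun φ := (hk.memLp_integral φ).toLp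
      map_add' := hk.memLp_integral_toLp_add
      map_smul' := hk.memLp_integral_toLp_smul } C fun φ => by
    rw [LinearMap.coe_mk, AddHom.coe_mk, Lp.norm_toLp, Lp.norm_def, ← ENNReal.coe_toReal,
      ← ENNReal.toReal_mul]
    exact ENNReal.toReal_mono (ENNReal.mul_ne_top ENNReal.coe_ne_top (Lp.eLpNorm_ne_top φ))
      (hk.eLpNorm_integral_le φ)

theorem coeFn_toLp (hk : IsSchurKernel k μ ν C) (φ : Lp F 2 ν) :
    hk.toLp (𝕜 := 𝕜) φ =ᵐ[μ] fun x => ∫ y, k x y • φ y ∂ν :=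
  (hk.memLp_integral φ).coeFn_toLp

end IsSchurKernel

end SchurTest

section NPKernelOperators

variable {r ρ : ℝ}

theorem integral_invDist_one (ξ : UnitSphere E3) :
    ∫ ω, invDist 1 (inner ℝ ξ.1 ω.1) ∂sphereMeasure E3 = 4 * Real.pi := by
  have h := zonalPotential_at_one hasSphericalLaplacian_one ξ
  simp only [zonalPotential, zonalIntegral_one, Nat.cast_zero, mul_zero, zero_add, div_one,
    ContinuousMap.one_apply, mul_one] at h
  exact_mod_cast h

theorem lintegral_npKernel_self (hr : 0 < r) (ξ : UnitSphere E3) :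
    ∫⁻ y, ‖npKernel (r • ξ.1) y‖ₑ ∂surfaceMeasure r = ENNReal.ofReal 2⁻¹ := by
  have henorm : ∀ ω : UnitSphere E3, ‖npKernel (r • ξ.1) (r • ω.1)‖ₑ
      = ENNReal.ofReal ((8 * Real.pi * r ^ 2)⁻¹ * invDist 1 (inner ℝ ξ.1 ω.1)) := fun ω => by
    rw [npKernel_smul_self hr]
    exact Real.enorm_eq_ofReal (mul_nonneg (by positivity) (invDist_nonneg _ _))
  rw [lintegral_surfaceMeasure hr, lintegral_congr henorm, ← ofReal_integral_eq_lintegral_ofReal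
    ((integrable_invDist_one ξ).const_mul _) (.of_forall fun ω => mul_nonneg (by positivity)
      (invDist_nonneg _ _)), integral_const_mul, integral_invDist_one,
    ← ENNReal.ofReal_mul (sq_nonneg r)]
  congr 1
  field_simp
  norm_num

theorem npKernel_smul_self_comm (hr : 0 < r) (ξ ω : UnitSphere E3) :
    npKernel (r • ξ.1) (r • ω.1) = npKernel (r • ω.1) (r • ξ.1) := by
  rw [npKernel_smul_self hr, npKernel_smul_self hr, real_inner_comm]

theorem isSchurKernel_npKernel_self (hr : 0 < r) :
    IsSchurKernel npKernel (surfaceMeasure r) (surfaceMeasure r) (Real.toNNReal 2⁻¹) where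
  measurable := measurable_npKernel
  lintegral_right_le := by
    exact (ae_surfaceMeasure_iff hr).2 (.of_forall fun ξ => (lintegral_npKernel_self hr ξ).le)
  lintegral_left_le := by
    refine (ae_surfaceMeasure_iff hr).2 (.of_forall fun ξ => ?_)
    have hsymm : ∫⁻ x, ‖npKernel x (r • ξ.1)‖ₑ ∂surfaceMeasure r
        = ∫⁻ y, ‖npKernel (r • ξ.1) y‖ₑ ∂surfaceMeasure r := by
      simp only [lintegral_surfaceMeasure hr, npKernel_smul_self_comm hr ξ]
    exact (hsymm.trans (lintegral_npKernel_self hr ξ)).le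



theorem exists_isSchurKernel_npKernel (hr : 0 < r) (hρ : 0 < ρ) :
    ∃ C, IsSchurKernel npKernel (surfaceMeasure ρ) (surfaceMeasure r) C := by
  rcases eq_or_ne ρ r with rfl | hne
  · exact ⟨_, isSchurKernel_npKernel_self hr⟩
  refine ⟨_, .of_ae_bound (B := (4 * Real.pi * |ρ - r| ^ 2)⁻¹.toNNReal) measurable_npKernel ?_⟩
  filter_upwards [ae_norm_eq hρ] with x hx
  filter_upwards [ae_norm_eq hr] with y hy
  rw [← ofReal_norm]
  refine ENNReal.ofReal_le_ofReal (norm_npKernel_le (abs_pos.2 (sub_ne_zero.2 hne)) ?_)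
  simpa only [hx, hy] using abs_norm_sub_norm_le x y

end NPKernelOperators

section SingleLayer

variable {r d : ℝ} {φ : E3 → ℂ} {x : E3}

theorem le_norm_sub_of_mem_ball (hd : 2 * d ≤ |‖x‖ - r|) {y z : E3} (hy : ‖y‖ = r)
    (hz : z ∈ ball x d) : d ≤ ‖z - y‖ := by
  have hxy : |‖x‖ - r| ≤ ‖x - y‖ := hy ▸ abs_norm_sub_norm_le x y
  have htri : ‖x - y‖ ≤ ‖x - z‖ + ‖z - y‖ := norm_sub_le_norm_sub_add_norm_sub x z y
  rw [mem_ball', dist_eq_norm] at hz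
  linarith

theorem measurable_fundSol : Measurable fundSol := by
  unfold fundSol
  fun_prop

theorem aestronglyMeasurable_fundSol_smul (hφ : Integrable φ (surfaceMeasure r)) (x : E3) :
    AEStronglyMeasurable (fun y => fundSol (x - y) • φ y) (surfaceMeasure r) :=
  (measurable_fundSol.comp (measurable_const.sub measurable_id)).aestronglyMeasurable.smul hφ.1

theorem integrable_fundSol_smul (hr : 0 < r) (hφ : Integrable φ (surfaceMeasure r))
    (hx : ‖x‖ ≠ r) : Integrable (fun y => fundSol (x - y) • φ y) (surfaceMeasure r) := by
  have : 0 < |‖x‖ - r| := abs_pos.2 (sub_ne_zero.2 hx)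
  refine (hφ.norm.const_mul (4 * Real.pi * |‖x‖ - r|)⁻¹).mono'
    (aestronglyMeasurable_fundSol_smul hφ x) ?_
  filter_upwards [ae_norm_eq hr] with y hy
  have hxy : |‖x‖ - r| ≤ ‖x - y‖ := hy ▸ abs_norm_sub_norm_le x y
  rw [norm_smul, fundSol, norm_neg, one_div, Real.norm_of_nonneg (by positivity)]
  gcongr

theorem hasFDerivAt_singleLayer (hr : 0 < r) (hφ : Integrable φ (surfaceMeasure r))
    (hx : ‖x‖ ≠ r) :
    Integrable (fun y => (fderiv ℝ fundSol (x - y)).smulRight (φ y)) (surfaceMeasure r) ∧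
      HasFDerivAt (singleLayer r φ)
        (∫ y, (fderiv ℝ fundSol (x - y)).smulRight (φ y) ∂surfaceMeasure r) x := by
  obtain ⟨d, hd, hdx⟩ : ∃ d, 0 < d ∧ 2 * d ≤ |‖x‖ - r| :=
    ⟨|‖x‖ - r| / 2, half_pos (abs_pos.2 (sub_ne_zero.2 hx)), by linarith⟩
  have hmeas : AEStronglyMeasurable (fun y => (fderiv ℝ fundSol (x - y)).smulRight (φ y))
      (surfaceMeasure r) :=
    (ContinuousLinearMap.smulRightL ℝ E3 ℂ).aestronglyMeasurable_comp₂ ((measurable_fderiv ℝ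
      fundSol).comp (measurable_const.sub measurable_id)).aestronglyMeasurable hφ.1
  have hbound : ∀ᵐ y ∂surfaceMeasure r, ∀ z ∈ ball x d,
      ‖(fderiv ℝ fundSol (z - y)).smulRight (φ y)‖ ≤ (4 * Real.pi * d ^ 2)⁻¹ * ‖φ y‖ := by
    filter_upwards [ae_norm_eq hr] with y hy z hz
    rw [ContinuousLinearMap.norm_smulRight_apply]
    gcongr
    exact norm_fderiv_fundSol_le hd (le_norm_sub_of_mem_ball hdx hy hz)
  have hderiv : ∀ᵐ y ∂surfaceMeasure r, ∀ z ∈ ball x d,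
      HasFDerivAt (fun z => fundSol (z - y) • φ y)
        ((fderiv ℝ fundSol (z - y)).smulRight (φ y)) z := by
    filter_upwards [ae_norm_eq hr] with y hy z hz
    have hzy : z - y ≠ 0 := norm_pos_iff.1 (hd.trans_le (le_norm_sub_of_mem_ball hdx hy hz))
    exact ((hasFDerivAt_comp_sub y).2
      (hasFDerivAt_fundSol hzy).differentiableAt.hasFDerivAt).smul_const (φ y)
  have hdom := hφ.norm.const_mul (4 * Real.pi * d ^ 2)⁻¹
  exact ⟨hdom.mono' hmeas (hbound.mono fun y hy => hy x (mem_ball_self hd)),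
    hasFDerivAt_integral_of_dominated_of_fderiv_le (ball_mem_nhds x hd)
      (.of_forall (aestronglyMeasurable_fundSol_smul hφ)) (integrable_fundSol_smul hr hφ hx)
      hmeas hbound hdom hderiv⟩

theorem normalDeriv_singleLayer (hr : 0 < r) (hφ : Integrable φ (surfaceMeasure r))
    (hx : ‖x‖ ≠ r) :
    normalDeriv (singleLayer r φ) x = ∫ y, npKernel x y • φ y ∂surfaceMeasure r := by
  obtain ⟨hint, hderiv⟩ := hasFDerivAt_singleLayer hr hφ hx
  rw [normalDeriv, hderiv.fderiv, ContinuousLinearMap.integral_apply hint]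
  rfl

variable {n : ℕ} {p : MvPolynomial (Fin 3) ℂ}

theorem integrable_angular (r : ℝ) (p : MvPolynomial (Fin 3) ℂ) :
    Integrable (angular p) (surfaceMeasure r) :=
  (memLp_angular r p).integrable one_le_two

theorem normalDeriv_singleLayer_angular_of_norm_lt (hp : p ∈ harmonicSubmodule (Fin 3) ℂ n)
    (hx0 : x ≠ 0) (hx : ‖x‖ < r) :
    normalDeriv (singleLayer r (angular p)) x
      = -(n / (2 * n + 1) * (‖x‖ / r) ^ (n - 1)) * angular p x := by
  have hr := (norm_nonneg x).trans_lt hx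
  rw [normalDeriv_singleLayer hr (integrable_angular r p) hx.ne,
    integral_npKernel_angular_of_norm_lt hr hp hx0 hx]

theorem normalDeriv_singleLayer_angular_of_lt_norm (hr : 0 < r)
    (hp : p ∈ harmonicSubmodule (Fin 3) ℂ n) (hx : r < ‖x‖) :
    normalDeriv (singleLayer r (angular p)) x
      = (n + 1) / (2 * n + 1) * (r / ‖x‖) ^ (n + 2) * angular p x := by
  rw [normalDeriv_singleLayer hr (integrable_angular r p) hx.ne',
    integral_npKernel_angular_of_lt_norm hr hp hx]

end SingleLayer

section ExistsNPOperator

variable {ri re : ℝ}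

theorem exists_isNPOperator (hri : 0 < ri) (hre : ri < re) :
    ∃ T : DensitySpace ri re →L[ℂ] DensitySpace ri re, IsNPOperator ri re T := by
  have hre0 := hri.trans hre
  obtain ⟨_, hii⟩ := exists_isSchurKernel_npKernel hri hri
  obtain ⟨_, hie⟩ := exists_isSchurKernel_npKernel hre0 hri
  obtain ⟨_, hei⟩ := exists_isSchurKernel_npKernel hri hre0
  obtain ⟨_, hee⟩ := exists_isSchurKernel_npKernel hre0 hre0
  let P : DensitySpace ri re →L[ℂ] Lp ℂ 2 (surfaceMeasure ri) := .fst ℂ _ _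
  let Q : DensitySpace ri re →L[ℂ] Lp ℂ 2 (surfaceMeasure re) := .snd ℂ _ _
  refine ⟨(-hii.toLp.comp P - hie.toLp.comp Q).prod (hei.toLp.comp P + hee.toLp.comp Q),
    fun φ => ⟨?_, ?_⟩⟩
  · have hint := (Lp.memLp φ.2).integrable one_le_two
    filter_upwards [Lp.coeFn_sub (-hii.toLp (𝕜 := ℂ) φ.1) (hie.toLp (𝕜 := ℂ) φ.2),
      Lp.coeFn_neg (hii.toLp (𝕜 := ℂ) φ.1), hii.coeFn_toLp (𝕜 := ℂ) φ.1,
      hie.coeFn_toLp (𝕜 := ℂ) φ.2, ae_norm_eq hri] with x hsub hneg h₁ h₂ hx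
    refine hsub.trans ?_
    rw [Pi.sub_apply, hneg, Pi.neg_apply, h₁, h₂,
      normalDeriv_singleLayer hre0 hint (hx.trans_ne hre.ne)]
    rfl
  · have hint := (Lp.memLp φ.1).integrable one_le_two
    filter_upwards [Lp.coeFn_add (hei.toLp (𝕜 := ℂ) φ.1) (hee.toLp (𝕜 := ℂ) φ.2),
      hei.coeFn_toLp (𝕜 := ℂ) φ.1, hee.coeFn_toLp (𝕜 := ℂ) φ.2, ae_norm_eq hre0]
      with x hadd h₁ h₂ hx
    refine hadd.trans ?_
    rw [Pi.add_apply, h₁, h₂, normalDeriv_singleLayer hri hint (hx.trans_ne hre.ne')]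
    rfl

end ExistsNPOperator

section Completeness

variable {ι : Type*} [Fintype ι]

theorem restrictSphere_map_conj (p : MvPolynomial ι ℂ) :
    restrictSphere (map (starRingEnd ℂ) p) = star (restrictSphere p) := by
  ext ω
  induction p using MvPolynomial.induction_on with
  | C a => simp [restrictSphere]
  | add p q hp hq => simp_all
  | mul_X p i hp => simp_all [restrictSphere_X]

theorem map_conj_mem_harmonicSubmodule {n : ℕ} {p : MvPolynomial ι ℂ}
    (hp : p ∈ harmonicSubmodule ι ℂ n) :
    map (starRingEnd ℂ) p ∈ harmonicSubmodule ι ℂ n := by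
  rw [mem_harmonicSubmodule, polyLaplacian_apply] at hp ⊢
  refine ⟨hp.1.map _, ?_⟩
  simp only [pderiv_map, ← map_sum, hp.2, map_zero]

theorem integral_restrictSphere_mul_conj_eq_zero [Nontrivial ι] {m n : ℕ} (hmn : m ≠ n)
    {p q : MvPolynomial ι ℂ} (hp : p ∈ harmonicSubmodule ι ℂ m)
    (hq : q ∈ harmonicSubmodule ι ℂ n) :
    ∫ ω, restrictSphere p ω * starRingEnd ℂ (restrictSphere q ω)
      ∂sphereMeasure (EuclideanSpace ℝ ι) = 0 := by
  rw [← integral_restrictSphere_mul_eq_zero hmn hp (map_conj_mem_harmonicSubmodule hq)]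
  simp only [restrictSphere_map_conj]
  rfl

theorem separatesPoints_range_restrictSphere :
    ((restrictSphere (ι := ι)).range : Subalgebra ℂ _).SeparatesPoints := by
  intro ω ω' hne
  obtain ⟨i, hi⟩ : ∃ i, ω.1 i ≠ ω'.1 i := by
    by_contra! h
    exact hne (Subtype.ext (PiLp.ext h))
  refine ⟨_, ⟨restrictSphere (X i), ⟨X i, rfl⟩, rfl⟩, ?_⟩
  simpa only [restrictSphere_X, ne_eq, Complex.ofReal_inj] using hi

theorem denseRange_restrictSphere : DenseRange (restrictSphere (ι := ι)) := by
  let A : StarSubalgebra ℂ C(UnitSphere (EuclideanSpace ℝ ι), ℂ) :=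
    { restrictSphere.range with
      star_mem' := by
        rintro _ ⟨p, rfl⟩
        exact ⟨map (starRingEnd ℂ) p, restrictSphere_map_conj p⟩ }
  have htop := ContinuousMap.starSubalgebra_topologicalClosure_eq_top_of_separatesPoints A
    separatesPoints_range_restrictSphere
  exact fun f => (htop ▸ StarSubalgebra.mem_top : f ∈ A.topologicalClosure)

variable [Nonempty ι]

theorem restrictSphere_mem_iSup_of_isHomogeneous {n : ℕ} {p : MvPolynomial ι ℂ}
    (hp : p.IsHomogeneous n) :
    restrictSphere p ∈
      ⨆ k, (harmonicSubmodule ι ℂ k).map (restrictSphere (ι := ι)).toLinearMap := by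
  induction n using Nat.twoStepInduction generalizing p with
  | zero | one =>
    exact Submodule.mem_iSup_of_mem _ (Submodule.mem_map_of_mem (mem_harmonicSubmodule.2
      ⟨hp, polyLaplacian_eq_zero_of_isHomogeneous_of_lt_two hp (by norm_num)⟩))
  | more n ih _ =>
    obtain ⟨h, hh, q, hq, rfl⟩ := exists_harmonic_add_normSqPoly_mul hp
    rw [map_add, map_mul, restrictSphere_normSqPoly, one_mul]
    exact Submodule.add_mem _
      (Submodule.mem_iSup_of_mem (n + 2) (Submodule.mem_map_of_mem hh)) (ih hq)

theorem restrictSphere_mem_iSup (p : MvPolynomial ι ℂ) :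
    restrictSphere p ∈
      ⨆ k, (harmonicSubmodule ι ℂ k).map (restrictSphere (ι := ι)).toLinearMap := by
  rw [← sum_homogeneousComponent p, map_sum]
  exact Submodule.sum_mem _ fun n _ =>
    restrictSphere_mem_iSup_of_isHomogeneous (homogeneousComponent_isHomogeneous n p)

theorem ae_eq_zero_of_integral_mul_conj_harmonic_eq_zero
    {u : UnitSphere (EuclideanSpace ℝ ι) → ℂ} (hu : MemLp u 2 (sphereMeasure _))
    (h : ∀ n, ∀ p ∈ harmonicSubmodule ι ℂ n,
      ∫ ω, u ω * starRingEnd ℂ (restrictSphere p ω) ∂sphereMeasure _ = 0) :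
    u =ᵐ[sphereMeasure _] 0 := by
  let L : C(UnitSphere (EuclideanSpace ℝ ι), ℂ) →L[ℂ] Lp ℂ 2 (sphereMeasure _) :=
    ContinuousMap.toLp 2 _ ℂ
  have hinner : ∀ f, inner ℂ (L f) hu.toLp
      = ∫ ω, u ω * starRingEnd ℂ (f ω) ∂sphereMeasure _ := fun f => by
    rw [L2.inner_def]
    refine integral_congr_ae ?_
    filter_upwards [ContinuousMap.coeFn_toLp (p := 2) (𝕜 := ℂ) (sphereMeasure _) f,
      hu.coeFn_toLp] with ω hf hω
    change inner ℂ (ContinuousMap.toLp 2 _ ℂ f ω) _ = _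
    rw [hf, hω, RCLike.inner_apply]
  have hle : ⨆ k, (harmonicSubmodule ι ℂ k).map (restrictSphere (ι := ι)).toLinearMap
      ≤ (ℂ ∙ hu.toLp)ᗮ.comap L.toLinearMap := by
    refine iSup_le fun n => Submodule.map_le_iff_le_comap.2 fun p hp => ?_
    exact Submodule.mem_orthogonal_singleton_iff_inner_left.2 ((hinner _).trans (h n p hp))
  have hL : DenseRange L := ContinuousMap.toLp_denseRange ℂ _ ℂ ENNReal.ofNat_ne_top
  have hdense := hL.comp denseRange_restrictSphere L.continuous
  have hzero := hdense.eq_zero_of_inner_right ℂ fun p =>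
    Submodule.mem_orthogonal_singleton_iff_inner_left.1 (hle (restrictSphere_mem_iSup p))
  exact (MemLp.toLp_eq_toLp_iff hu MemLp.zero).1 hzero

end Completeness

section AngularLp

variable {r : ℝ}

theorem coeFn_angularLp (r : ℝ) (p : MvPolynomial (Fin 3) ℂ) :
    angularLp r p =ᵐ[surfaceMeasure r] angular p := (memLp_angular r p).coeFn_toLp

/-- `angularLp` as a linear map. -/
def angularLpLinear (r : ℝ) : MvPolynomial (Fin 3) ℂ →ₗ[ℂ] Lp ℂ 2 (surfaceMeasure r) where
  toFun := angularLp r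
  map_add' p q := by
    simp only [angularLp, ← MemLp.toLp_add]
    congr
    exact funext fun x => map_add _ p q
  map_smul' c p := by
    simp only [angularLp, ← MemLp.toLp_const_smul]
    congr
    exact funext fun x => smul_eval _ p c

theorem angularLpLinear_apply (p : MvPolynomial (Fin 3) ℂ) :
    angularLpLinear r p = angularLp r p := rfl

theorem restrictSphere_eq_zero_of_angularLp_eq_zero (hr : 0 < r) {p : MvPolynomial (Fin 3) ℂ}
    (hp : angularLp r p = 0) : restrictSphere p = 0 := by
  have hae := (coeFn_angularLp r p).symm.trans (hp ▸ Lp.coeFn_zero ℂ 2 (surfaceMeasure r))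
  rw [EventuallyEq, ae_surfaceMeasure_iff hr] at hae
  simp only [angular_smul hr] at hae
  exact DFunLike.coe_injective
    ((Continuous.ae_eq_iff_eq (sphereMeasure E3) (map_continuous _) continuous_zero).1 hae)

theorem exists_mem_harmonicSubmodule_angularLp_ne_zero (hr : 0 < r) (n : ℕ) :
    ∃ p ∈ harmonicSubmodule (Fin 3) ℂ n, angularLp r p ≠ 0 := by
  have hiso : ∑ i, ![1, Complex.I, 0] i ^ 2 = 0 := by simp [Fin.sum_univ_three]
  refine ⟨_, pow_isotropic_mem_harmonicSubmodule hiso n, fun h => ?_⟩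
  have heval := DFunLike.congr_fun (restrictSphere_eq_zero_of_angularLp_eq_zero hr h)
    ⟨EuclideanSpace.single 0 1, by simp⟩
  simp [Fin.sum_univ_three, restrictSphere] at heval

theorem memLp_comp_smul_sphere (hr : 0 < r) {φ : E3 → ℂ} (hφ : MemLp φ 2 (surfaceMeasure r)) :
    MemLp (fun ω : UnitSphere E3 => φ (r • ω.1)) 2 (sphereMeasure E3) := by
  have hc : ENNReal.ofReal (r ^ 2) ≠ 0 := by simpa using hr.ne'
  have h := hφ.smul_measure (ENNReal.inv_ne_top.2 hc)
  rw [surfaceMeasure, smul_smul, ENNReal.inv_mul_cancel hc ENNReal.ofReal_ne_top, one_smul] at h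
  exact (measurableEmbedding_smul_sphere hr).memLp_map_measure_iff.1 h

/-- The coefficient of a density along `x ↦ p(x̂)`: the `L²` inner product divided by `r ^ 2`, so
that it does not depend on the radius of the sphere. -/
def angularCoeff (r : ℝ) (p : MvPolynomial (Fin 3) ℂ) : Lp ℂ 2 (surfaceMeasure r) →L[ℂ] ℂ :=
  ((r : ℂ) ^ 2)⁻¹ • innerSL ℂ (angularLp r p)

theorem angularCoeff_eq_zero_iff_inner (hr : 0 < r) {p : MvPolynomial (Fin 3) ℂ}
    {φ : Lp ℂ 2 (surfaceMeasure r)} :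
    angularCoeff r p φ = 0 ↔ inner ℂ (angularLp r p) φ = 0 := by
  simp [angularCoeff, hr.ne']

theorem angularCoeff_eq_zero_of_mem_span (hr : 0 < r) {s : Set (MvPolynomial (Fin 3) ℂ)}
    {φ : Lp ℂ 2 (surfaceMeasure r)} (hs : ∀ p ∈ s, angularCoeff r p φ = 0)
    {p : MvPolynomial (Fin 3) ℂ} (hp : p ∈ Submodule.span ℂ s) : angularCoeff r p φ = 0 := by
  have hle : Submodule.span ℂ s ≤ (ℂ ∙ φ)ᗮ.comap (angularLpLinear r) :=
    Submodule.span_le.2 fun q hq => Submodule.mem_orthogonal_singleton_iff_inner_left.2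
      ((angularCoeff_eq_zero_iff_inner hr).1 (hs q hq))
  exact (angularCoeff_eq_zero_iff_inner hr).2
    (Submodule.mem_orthogonal_singleton_iff_inner_left.1 (hle hp))

theorem angularCoeff_eq_integral (hr : 0 < r) (p : MvPolynomial (Fin 3) ℂ)
    (φ : Lp ℂ 2 (surfaceMeasure r)) :
    angularCoeff r p φ = ∫ ω : UnitSphere E3,
      φ (r • ω.1) * starRingEnd ℂ (restrictSphere p ω) ∂sphereMeasure E3 := by
  have hinner : inner ℂ (angularLp r p) φ
      = ∫ x, φ x * starRingEnd ℂ (angular p x) ∂surfaceMeasure r := by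
    rw [L2.inner_def]
    refine integral_congr_ae ?_
    filter_upwards [coeFn_angularLp r p] with x hx
    rw [hx, RCLike.inner_apply]
  have hr2 : (r : ℂ) ^ 2 ≠ 0 := pow_ne_zero 2 (by exact_mod_cast hr.ne')
  rw [angularCoeff, smul_apply, innerSL_apply_apply, hinner, integral_surfaceMeasure hr,
    Complex.real_smul, smul_eq_mul, Complex.ofReal_pow, inv_mul_cancel_left₀ hr2]
  simp only [angular_smul hr]

theorem angularCoeff_angularLp (hr : 0 < r) (p q : MvPolynomial (Fin 3) ℂ) :
    angularCoeff r p (angularLp r q) = ∫ ω : UnitSphere E3,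
      restrictSphere q ω * starRingEnd ℂ (restrictSphere p ω) ∂sphereMeasure E3 := by
  rw [angularCoeff_eq_integral hr]
  refine integral_congr_ae ?_
  filter_upwards [(ae_surfaceMeasure_iff hr).1 (coeFn_angularLp r q)] with ω hω
  rw [hω, angular_smul hr]

theorem angularCoeff_angularLp_eq_zero (hr : 0 < r) {m n : ℕ} (hmn : m ≠ n)
    {p q : MvPolynomial (Fin 3) ℂ} (hp : p ∈ harmonicSubmodule (Fin 3) ℂ m)
    (hq : q ∈ harmonicSubmodule (Fin 3) ℂ n) : angularCoeff r p (angularLp r q) = 0 :=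
  (angularCoeff_angularLp hr p q).trans (integral_restrictSphere_mul_conj_eq_zero hmn.symm hq hp)

theorem eq_zero_of_angularCoeff_eq_zero (hr : 0 < r) {φ : Lp ℂ 2 (surfaceMeasure r)}
    (h : ∀ n, ∀ p ∈ harmonicSubmodule (Fin 3) ℂ n, angularCoeff r p φ = 0) : φ = 0 := by
  have hae := ae_eq_zero_of_integral_mul_conj_harmonic_eq_zero
    (memLp_comp_smul_sphere hr (Lp.memLp φ))
    fun n p hp => (angularCoeff_eq_integral hr p φ).symm.trans (h n p hp)
  exact Lp.eq_zero_iff_ae_eq_zero.2 ((ae_surfaceMeasure_iff hr).2 hae)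

theorem iSup_map_angularLp_topologicalClosure (hr : 0 < r) :
    (⨆ n, (harmonicSubmodule (Fin 3) ℂ n).map (angularLpLinear r)).topologicalClosure = ⊤ := by
  rw [Submodule.topologicalClosure_eq_top_iff, Submodule.eq_bot_iff]
  intro φ hφ
  refine eq_zero_of_angularCoeff_eq_zero hr fun n p hp => ?_
  exact (angularCoeff_eq_zero_iff_inner hr).2 ((Submodule.mem_orthogonal _ _).1 hφ _
    (Submodule.mem_iSup_of_mem n (Submodule.mem_map_of_mem hp)))

theorem eq_of_apply_angularLp_eq {F : Type*} [TopologicalSpace F] [T2Space F] [AddCommMonoid F]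
    [Module ℂ F] (hr : 0 < r) {f g : Lp ℂ 2 (surfaceMeasure r) →L[ℂ] F}
    (h : ∀ n, ∀ p ∈ harmonicSubmodule (Fin 3) ℂ n, f (angularLp r p) = g (angularLp r p)) :
    f = g := by
  have hdense := (Submodule.dense_iff_topologicalClosure_eq_top).2
    (iSup_map_angularLp_topologicalClosure hr)
  have hle : ⨆ n, (harmonicSubmodule (Fin 3) ℂ n).map (angularLpLinear r)
      ≤ LinearMap.eqLocus f.toLinearMap g.toLinearMap :=
    iSup_le fun n => Submodule.map_le_iff_le_comap.2 fun p hp => h n p hp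
  exact DFunLike.coe_injective (f.continuous.ext_on hdense g.continuous fun φ hφ => hle hφ)

end AngularLp

namespace IsOrthonormalSphericalHarmonics

variable {n : ℕ} {Y : Set.Icc (-(n : ℤ)) n → MvPolynomial (Fin 3) ℂ} {r : ℝ}

theorem mem_harmonicSubmodule (hY : IsOrthonormalSphericalHarmonics n Y) (m) :
    Y m ∈ harmonicSubmodule (Fin 3) ℂ n :=
  ⟨hY.homogeneous m, (polyLaplacian_apply _).trans (hY.harmonic m)⟩

theorem angularCoeff_angularLp (hY : IsOrthonormalSphericalHarmonics n Y) (hr : 0 < r) (m m') :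
    angularCoeff r (Y m) (angularLp r (Y m')) = if m = m' then 1 else 0 := by
  have horth := hY.orthonormal m' m
  rw [integral_surfaceMeasure one_pos, one_pow, one_smul] at horth
  simp only [angular_smul one_pos] at horth
  rw [_root_.angularCoeff_angularLp hr, horth]
  simp only [eq_comm]

theorem angularLp_ne_zero (hY : IsOrthonormalSphericalHarmonics n Y) (hr : 0 < r) (m) :
    angularLp r (Y m) ≠ 0 := fun h => by
  simpa [h] using hY.angularCoeff_angularLp hr m m

theorem linearIndependent (hY : IsOrthonormalSphericalHarmonics n Y) : LinearIndependent ℂ Y := by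
  classical
  rw [Fintype.linearIndependent_iff]
  intro c hc m
  have hcoeff := congrArg (angularCoeff 1 (Y m) ∘ angularLpLinear 1) hc
  simp only [Function.comp_apply, map_zero, map_sum, map_smul, angularLpLinear_apply] at hcoeff
  simpa [hY.angularCoeff_angularLp one_pos] using hcoeff

theorem span_range (hY : IsOrthonormalSphericalHarmonics n Y) :
    Submodule.span ℂ (Set.range Y) = harmonicSubmodule (Fin 3) ℂ n := by
  refine Submodule.eq_of_le_of_finrank_le
    (Submodule.span_le.2 (Set.range_subset_iff.2 hY.mem_harmonicSubmodule)) ?_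
  have hle := finrank_harmonicSubmodule_le (K := ℂ) n
  have hcard := Int.card_fintype_Icc_of_le (a := -(n : ℤ)) (b := n) (by omega)
  rw [finrank_span_eq_card hY.linearIndependent]
  omega

theorem eq_sum (hY : IsOrthonormalSphericalHarmonics n Y) (hr : 0 < r)
    {φ : Lp ℂ 2 (surfaceMeasure r)}
    (hφ : ∀ k, k ≠ n → ∀ p ∈ harmonicSubmodule (Fin 3) ℂ k, angularCoeff r p φ = 0) :
    φ = ∑ m, angularCoeff r (Y m) φ • angularLp r (Y m) := by
  rw [← sub_eq_zero]
  refine eq_zero_of_angularCoeff_eq_zero hr fun k p hp => ?_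
  rcases eq_or_ne k n with rfl | hk
  · rw [← hY.span_range] at hp
    refine angularCoeff_eq_zero_of_mem_span hr (Set.forall_mem_range.2 fun m => ?_) hp
    simp [hY.angularCoeff_angularLp hr]
  · have hother : ∀ m, angularCoeff r p (angularLp r (Y m)) = 0 := fun m =>
      angularCoeff_angularLp_eq_zero hr hk hp (hY.mem_harmonicSubmodule m)
    simp [hφ k hk p hp, hother]

end IsOrthonormalSphericalHarmonics

section NPMatrix

open Matrix

variable {ρ : ℝ} {n : ℕ}

/-- The action of `𝕂*` on pairs of spherical harmonics of degree `n`, for `ρ = ri / re`. At `n = 0`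
the truncated exponent `n - 1` is harmless because of the factor `n`. -/
def npMatrix (ρ : ℝ) (n : ℕ) : Matrix (Fin 2) (Fin 2) ℂ :=
  !![-(1 / (2 * (2 * n + 1))), n / (2 * n + 1) * ρ ^ (n - 1);
    (n + 1) / (2 * n + 1) * ρ ^ (n + 2), 1 / (2 * (2 * n + 1))]

/-- The coefficients of `npPair` along `x ↦ p(x̂)`. -/
def npVector (ρ : ℝ) (n : ℕ) (s : ℝ) : Fin 2 → ℂ :=
  ![((s - 1 : ℝ) : ℂ), ((2 * (n + 1) * ρ ^ (n + 2) : ℝ) : ℂ)]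

theorem npRoot_sq (hρ : 0 ≤ ρ) (n : ℕ) :
    npRoot ρ n ^ 2 = 1 + 4 * n * (n + 1) * ρ ^ (2 * n + 1) :=
  Real.sq_sqrt (by positivity)

theorem npEigenvalue_sq (hρ : 0 ≤ ρ) (n : ℕ) :
    npEigenvalue ρ n ^ 2
      = 1 / 4 * (1 / (2 * n + 1) ^ 2 + (1 - 1 / (2 * n + 1) ^ 2) * ρ ^ (2 * n + 1)) := by
  rw [npEigenvalue, mul_pow, npRoot_sq hρ]
  field_simp
  ring

theorem strictAnti_npEigenvalue_sq (hρ : 0 ≤ ρ) (hρ1 : ρ < 1) :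
    StrictAnti fun n => npEigenvalue ρ n ^ 2 := by
  intro m n hmn
  simp only [npEigenvalue_sq hρ]
  have hweight : 1 / (2 * n + 1 : ℝ) ^ 2 < 1 / (2 * m + 1 : ℝ) ^ 2 := by gcongr
  have hweight1 : 1 / (2 * m + 1 : ℝ) ^ 2 ≤ 1 :=
    div_le_one_of_le₀ (one_le_pow₀ (by linarith [m.cast_nonneg (α := ℝ)])) (by positivity)
  have hpow : ρ ^ (2 * n + 1) ≤ ρ ^ (2 * m + 1) := pow_le_pow_of_le_one hρ hρ1.le (by omega)
  have hpow1 : ρ ^ (2 * n + 1) < 1 := pow_lt_one₀ hρ hρ1 (by omega)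
  nlinarith [mul_nonneg (sub_nonneg.2 hweight1) (sub_nonneg.2 hpow),
    mul_pos (sub_pos.2 hweight) (sub_pos.2 hpow1)]

theorem natCast_mul_pow_sub_one_mul_pow_add_two {R : Type*} [CommSemiring R] (x : R) (n : ℕ) :
    n * x ^ (n - 1) * x ^ (n + 2) = n * x ^ (2 * n + 1) := by
  cases n with
  | zero => simp
  | succ n => rw [Nat.add_sub_cancel]; ring

theorem npMatrix_mul_self (hρ : 0 ≤ ρ) (n : ℕ) :
    npMatrix ρ n * npMatrix ρ n = (npEigenvalue ρ n : ℂ) ^ 2 • (1 : Matrix (Fin 2) (Fin 2) ℂ) := by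
  have hn : (2 * n + 1 : ℂ) ≠ 0 := by exact_mod_cast (2 * n).succ_ne_zero
  have hsq : (npEigenvalue ρ n : ℂ) ^ 2
      = (1 / (2 * (2 * n + 1))) ^ 2
        + n / (2 * n + 1) * ρ ^ (n - 1) * ((n + 1) / (2 * n + 1) * ρ ^ (n + 2)) := by
    rw [← Complex.ofReal_pow, npEigenvalue_sq hρ n]
    push_cast
    field_simp
    linear_combination
      -(16 * (n + 1 : ℂ)) * natCast_mul_pow_sub_one_mul_pow_add_two (ρ : ℂ) n
  rw [hsq, npMatrix, mul_fin_two, one_fin_two]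
  ext i j
  fin_cases i <;> fin_cases j <;>
    simp only [Fin.zero_eta, Fin.mk_one, of_apply, Matrix.smul_apply, cons_val', cons_val_zero,
      cons_val_one, cons_val_fin_one, smul_eq_mul] <;>
    ring

theorem npMatrix_mulVec (v : Fin 2 → ℂ) :
    npMatrix ρ n *ᵥ v
      = ![-(1 / (2 * (2 * n + 1))) * v 0 + n / (2 * n + 1) * ρ ^ (n - 1) * v 1,
        (n + 1) / (2 * n + 1) * ρ ^ (n + 2) * v 0 + 1 / (2 * (2 * n + 1)) * v 1] := by
  rw [npMatrix, mulVec_fin_two]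
  rfl

theorem npMatrix_mulVec_npVector (hρ : 0 ≤ ρ) {s : ℝ} (hs : s ^ 2 = npRoot ρ n ^ 2) :
    npMatrix ρ n *ᵥ npVector ρ n s
      = ((1 / (2 * (2 * n + 1)) * s : ℝ) : ℂ) • npVector ρ n s := by
  have hpow := natCast_mul_pow_sub_one_mul_pow_add_two (ρ : ℂ) n
  have hn : (2 * n + 1 : ℂ) ≠ 0 := by exact_mod_cast (2 * n).succ_ne_zero
  have hsq : (s : ℂ) ^ 2 = 1 + 4 * n * (n + 1) * ρ ^ (2 * n + 1) := by
    exact_mod_cast hs.trans (npRoot_sq hρ n)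
  simp only [npMatrix_mulVec, npVector, cons_val_zero, cons_val_one, smul_cons, smul_empty,
    smul_eq_mul]
  push_cast
  refine vec2_eq ?_ ?_
  · field_simp
    linear_combination (4 * (n + 1 : ℂ)) * hpow - hsq
  · field_simp
    ring

theorem eq_zero_of_npMatrix_mulVec_eq_smul (hρ : 0 ≤ ρ) {z : ℂ}
    (hz : z ^ 2 ≠ (npEigenvalue ρ n : ℂ) ^ 2) {v : Fin 2 → ℂ}
    (hv : npMatrix ρ n *ᵥ v = z • v) : v = 0 := by
  have hsq : (npEigenvalue ρ n : ℂ) ^ 2 • v = z ^ 2 • v := calc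
    _ = (npMatrix ρ n * npMatrix ρ n) *ᵥ v := by
      rw [npMatrix_mul_self hρ, smul_mulVec, one_mulVec]
    _ = z ^ 2 • v := by rw [← mulVec_mulVec, hv, mulVec_smul, hv, smul_smul, sq]
  by_contra hv0
  exact hz (smul_left_injective ℂ hv0 hsq).symm

theorem exists_eq_smul_npVector (hρ : 0 < ρ) {s : ℝ} {v : Fin 2 → ℂ}
    (hv : npMatrix ρ n *ᵥ v = ((1 / (2 * (2 * n + 1)) * s : ℝ) : ℂ) • v) :
    ∃ t : ℂ, v = t • npVector ρ n s := by
  have hρC : (ρ : ℂ) ≠ 0 := by exact_mod_cast hρ.ne'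
  have hn : (n + 1 : ℂ) ≠ 0 := by exact_mod_cast n.succ_ne_zero
  have hn' : (2 * n + 1 : ℂ) ≠ 0 := by exact_mod_cast (2 * n).succ_ne_zero
  have hrow : 2 * (n + 1) * ρ ^ (n + 2) * v 0 = (s - 1) * v 1 := by
    have h : (n + 1) / (2 * n + 1) * ρ ^ (n + 2) * v 0 + 1 / (2 * (2 * n + 1)) * v 1
        = ((1 / (2 * (2 * n + 1)) * s : ℝ) : ℂ) * v 1 := by
      simpa only [npMatrix_mulVec, cons_val_one, cons_val_fin_one, Pi.smul_apply, smul_eq_mul]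
        using congrFun hv 1
    push_cast at h
    calc 2 * (n + 1) * ρ ^ (n + 2) * v 0
      _ = 2 * (2 * n + 1) * ((n + 1) / (2 * n + 1) * ρ ^ (n + 2) * v 0
            + 1 / (2 * (2 * n + 1)) * v 1) - v 1 := by field_simp; ring
      _ = (s - 1) * v 1 := by rw [h]; field_simp
  have hv0 : v 0 = v 1 / (2 * (n + 1) * ρ ^ (n + 2)) * (s - 1) := by
    field_simp
    linear_combination hrow
  have hv1 : v 1 = v 1 / (2 * (n + 1) * ρ ^ (n + 2)) * (2 * (n + 1) * ρ ^ (n + 2)) := by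
    field_simp
  refine ⟨v 1 / (2 * (n + 1) * ρ ^ (n + 2)), funext (Fin.forall_fin_two.2 ⟨?_, ?_⟩)⟩ <;>
    simp only [npVector, Pi.smul_apply, cons_val_zero, cons_val_one, cons_val_fin_one,
      smul_eq_mul] <;>
    push_cast
  exacts [hv0, hv1]

end NPMatrix

section HarmonicPair

variable {ri re : ℝ}

/-- The pair `(v₀ p(x̂), v₁ p(x̂))` in `ℋ`, as a linear function of `v`. -/
def harmonicPair (ri re : ℝ) (p : MvPolynomial (Fin 3) ℂ) :
    (Fin 2 → ℂ) →ₗ[ℂ] DensitySpace ri re :=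
  ((angularLpLinear ri).comp ((LinearMap.toSpanSingleton ℂ _ p).comp (.proj 0))).prod
    ((angularLpLinear re).comp ((LinearMap.toSpanSingleton ℂ _ p).comp (.proj 1)))

theorem harmonicPair_apply (p : MvPolynomial (Fin 3) ℂ) (v : Fin 2 → ℂ) :
    harmonicPair ri re p v = (angularLp ri (v 0 • p), angularLp re (v 1 • p)) := rfl

theorem npPair_eq_harmonicPair (n : ℕ) (s : ℝ) (p : MvPolynomial (Fin 3) ℂ) :
    npPair ri re n s p = harmonicPair ri re p (npVector (ri / re) n s) := by
  simp only [harmonicPair_apply, ← angularLpLinear_apply, map_smul]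
  simp [npPair, npVector, angularLpLinear_apply]

theorem npPair_ne_zero (hri : 0 < ri) (hre : 0 < re) (n : ℕ) (s : ℝ) {p : MvPolynomial (Fin 3) ℂ}
    (hp : angularLp re p ≠ 0) : npPair ri re n s p ≠ 0 := by
  have hcoeff : 2 * (n + 1) * (ri / re) ^ (n + 2) ≠ 0 := by positivity
  exact fun h => smul_ne_zero (Complex.ofReal_ne_zero.2 hcoeff) hp (congrArg Prod.snd h)

/-- The coefficients of a pair of densities along `x ↦ p(x̂)`. -/
def pairCoeff (ri re : ℝ) (p : MvPolynomial (Fin 3) ℂ) : DensitySpace ri re →L[ℂ] (Fin 2 → ℂ) :=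
  .pi ![(angularCoeff ri p).comp (.fst ℂ _ _), (angularCoeff re p).comp (.snd ℂ _ _)]

theorem pairCoeff_apply (p : MvPolynomial (Fin 3) ℂ) (φ : DensitySpace ri re) :
    pairCoeff ri re p φ = ![angularCoeff ri p φ.1, angularCoeff re p φ.2] := by
  ext i
  fin_cases i <;> rfl

theorem pairCoeff_eq_zero_iff {p : MvPolynomial (Fin 3) ℂ} {φ : DensitySpace ri re} :
    pairCoeff ri re p φ = 0 ↔ angularCoeff ri p φ.1 = 0 ∧ angularCoeff re p φ.2 = 0 := by
  simp [pairCoeff_apply]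

theorem pairCoeff_harmonicPair (hri : 0 < ri) (hre : 0 < re) (p q : MvPolynomial (Fin 3) ℂ)
    (v : Fin 2 → ℂ) :
    pairCoeff ri re p (harmonicPair ri re q v) = angularCoeff re p (angularLp re q) • v := by
  simp only [pairCoeff_apply, harmonicPair_apply, ← angularLpLinear_apply, map_smul]
  simp only [angularLpLinear_apply, angularCoeff_angularLp hri, angularCoeff_angularLp hre]
  ext i
  fin_cases i <;> simp [mul_comm]

theorem pairCoeff_harmonicPair_eq_zero (hri : 0 < ri) (hre : 0 < re) {m n : ℕ} (hmn : m ≠ n)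
    {p q : MvPolynomial (Fin 3) ℂ} (hp : p ∈ harmonicSubmodule (Fin 3) ℂ m)
    (hq : q ∈ harmonicSubmodule (Fin 3) ℂ n) (v : Fin 2 → ℂ) :
    pairCoeff ri re p (harmonicPair ri re q v) = 0 := by
  rw [pairCoeff_harmonicPair hri hre, angularCoeff_angularLp_eq_zero hre hmn hp hq, zero_smul]

theorem eq_of_apply_harmonicPair_eq {F : Type*} [TopologicalSpace F] [T2Space F] [AddCommMonoid F]
    [Module ℂ F] (hri : 0 < ri) (hre : 0 < re) {f g : DensitySpace ri re →L[ℂ] F}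
    (h : ∀ n, ∀ p ∈ harmonicSubmodule (Fin 3) ℂ n, ∀ v,
      f (harmonicPair ri re p v) = g (harmonicPair ri re p v)) : f = g := by
  refine ContinuousLinearMap.prod_ext (eq_of_apply_angularLp_eq hri fun n p hp => ?_)
    (eq_of_apply_angularLp_eq hre fun n p hp => ?_)
  · simpa [harmonicPair_apply, ← angularLpLinear_apply] using h n p hp ![1, 0]
  · simpa [harmonicPair_apply, ← angularLpLinear_apply] using h n p hp ![0, 1]

theorem eq_zero_of_pairCoeff_eq_zero (hri : 0 < ri) (hre : 0 < re) {φ : DensitySpace ri re}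
    (h : ∀ n, ∀ p ∈ harmonicSubmodule (Fin 3) ℂ n, pairCoeff ri re p φ = 0) : φ = 0 :=
  Prod.ext
    (eq_zero_of_angularCoeff_eq_zero hri fun n p hp => (pairCoeff_eq_zero_iff.1 (h n p hp)).1)
    (eq_zero_of_angularCoeff_eq_zero hre fun n p hp => (pairCoeff_eq_zero_iff.1 (h n p hp)).2)

theorem IsOrthonormalSphericalHarmonics.eq_sum_harmonicPair {n : ℕ}
    {Y : Set.Icc (-(n : ℤ)) n → MvPolynomial (Fin 3) ℂ} (hY : IsOrthonormalSphericalHarmonics n Y)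
    (hri : 0 < ri) (hre : 0 < re) {φ : DensitySpace ri re}
    (hφ : ∀ k, k ≠ n → ∀ p ∈ harmonicSubmodule (Fin 3) ℂ k, pairCoeff ri re p φ = 0) :
    φ = ∑ m, harmonicPair ri re (Y m) (pairCoeff ri re (Y m) φ) := by
  simp only [harmonicPair_apply, ← angularLpLinear_apply, map_smul, pairCoeff_apply]
  refine Prod.ext ?_ ?_
  · rw [Prod.fst_sum]
    exact hY.eq_sum hri fun k hk p hp => (pairCoeff_eq_zero_iff.1 (hφ k hk p hp)).1
  · rw [Prod.snd_sum]
    exact hY.eq_sum hre fun k hk p hp => (pairCoeff_eq_zero_iff.1 (hφ k hk p hp)).2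

end HarmonicPair

section Spectrum

open Matrix

theorem neumannPoincareStar_congr_ae {r : ℝ} {φ ψ : E3 → ℂ} (h : φ =ᵐ[surfaceMeasure r] ψ) :
    neumannPoincareStar r φ = neumannPoincareStar r ψ := by
  funext x
  exact integral_congr_ae (h.mono fun y hy => congrArg _ hy)

theorem singleLayer_congr_ae {r : ℝ} {φ ψ : E3 → ℂ} (h : φ =ᵐ[surfaceMeasure r] ψ) :
    singleLayer r φ = singleLayer r ψ := by
  funext x
  exact integral_congr_ae (h.mono fun y hy => congrArg _ hy)

theorem angular_smul_left (c : ℂ) (p : MvPolynomial (Fin 3) ℂ) (x : E3) :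
    angular (c • p) x = c * angular p x := smul_eval _ p c

namespace IsNPOperator

variable {ri re : ℝ} {T : DensitySpace ri re →L[ℂ] DensitySpace ri re} {n : ℕ}
  {p : MvPolynomial (Fin 3) ℂ}

theorem apply_harmonicPair (hT : IsNPOperator ri re T) (hri : 0 < ri) (hre : ri < re)
    (hp : p ∈ harmonicSubmodule (Fin 3) ℂ n) (v : Fin 2 → ℂ) :
    T (harmonicPair ri re p v) = harmonicPair ri re p (npMatrix (ri / re) n *ᵥ v) := by
  have hre0 := hri.trans hre
  obtain ⟨h₁, h₂⟩ := hT (harmonicPair ri re p v)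
  simp only [harmonicPair_apply, neumannPoincareStar_congr_ae (coeFn_angularLp _ _),
    singleLayer_congr_ae (coeFn_angularLp _ _)] at h₁ h₂ ⊢
  have hmem : ∀ c : ℂ, c • p ∈ harmonicSubmodule (Fin 3) ℂ n := fun c => Submodule.smul_mem _ c hp
  refine Prod.ext (Lp.ext ?_) (Lp.ext ?_)
  · filter_upwards [h₁, coeFn_angularLp ri ((npMatrix (ri / re) n *ᵥ v) 0 • p), ae_norm_eq hri]
      with x hx hv hnorm
    have hx0 : x ≠ 0 := norm_pos_iff.1 (hri.trans_eq hnorm.symm)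
    rw [hx, hv, neumannPoincareStar_angular hri (hmem _) hnorm,
      normalDeriv_singleLayer_angular_of_norm_lt (hmem _) hx0 (hnorm.trans_lt hre), hnorm]
    simp only [npMatrix_mulVec, angular_smul_left, cons_val_zero]
    push_cast
    ring
  · filter_upwards [h₂, coeFn_angularLp re ((npMatrix (ri / re) n *ᵥ v) 1 • p), ae_norm_eq hre0]
      with x hx hv hnorm
    rw [hx, hv, neumannPoincareStar_angular hre0 (hmem _) hnorm,
      normalDeriv_singleLayer_angular_of_lt_norm hri (hmem _) (hre.trans_eq hnorm.symm), hnorm]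
    simp only [npMatrix_mulVec, angular_smul_left, cons_val_zero, cons_val_one]
    push_cast
    ring

theorem pairCoeff_apply (hT : IsNPOperator ri re T) (hri : 0 < ri) (hre : ri < re)
    (hp : p ∈ harmonicSubmodule (Fin 3) ℂ n) (φ : DensitySpace ri re) :
    pairCoeff ri re p (T φ) = npMatrix (ri / re) n *ᵥ pairCoeff ri re p φ := by
  have hre0 := hri.trans hre
  let M : (Fin 2 → ℂ) →L[ℂ] (Fin 2 → ℂ) := (npMatrix (ri / re) n).mulVecLin.toContinuousLinearMap
  suffices (pairCoeff ri re p).comp T = M.comp (pairCoeff ri re p) from DFunLike.congr_fun this φ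
  refine eq_of_apply_harmonicPair_eq hri hre0 fun k q hq v => ?_
  change pairCoeff ri re p (T _) = npMatrix (ri / re) n *ᵥ pairCoeff ri re p _
  rw [hT.apply_harmonicPair hri hre hq]
  rcases eq_or_ne n k with rfl | hnk
  · rw [pairCoeff_harmonicPair hri hre0, pairCoeff_harmonicPair hri hre0, mulVec_smul]
  · rw [pairCoeff_harmonicPair_eq_zero hri hre0 hnk hp hq,
      pairCoeff_harmonicPair_eq_zero hri hre0 hnk hp hq, mulVec_zero]

theorem npMatrix_mulVec_pairCoeff (hT : IsNPOperator ri re T) (hri : 0 < ri) (hre : ri < re) {z : ℂ}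
    {φ : DensitySpace ri re} (hφ : T φ = z • φ) (hp : p ∈ harmonicSubmodule (Fin 3) ℂ n) :
    npMatrix (ri / re) n *ᵥ pairCoeff ri re p φ = z • pairCoeff ri re p φ := by
  rw [← hT.pairCoeff_apply hri hre hp, hφ, map_smul]

theorem apply_npPair (hT : IsNPOperator ri re T) (hri : 0 < ri) (hre : ri < re)
    (hp : p ∈ harmonicSubmodule (Fin 3) ℂ n) {s : ℝ} (hs : s ^ 2 = npRoot (ri / re) n ^ 2) :
    T (npPair ri re n s p) = ((1 / (2 * (2 * n + 1)) * s : ℝ) : ℂ) • npPair ri re n s p := by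
  have hρ : 0 ≤ ri / re := (div_pos hri (hri.trans hre)).le
  rw [npPair_eq_harmonicPair, hT.apply_harmonicPair hri hre hp, npMatrix_mulVec_npVector hρ hs,
    map_smul]

theorem hasEigenvector_npPair (hT : IsNPOperator ri re T) (hri : 0 < ri) (hre : ri < re)
    (hp : p ∈ harmonicSubmodule (Fin 3) ℂ n) (hp0 : angularLp re p ≠ 0) {s : ℝ}
    (hs : s ^ 2 = npRoot (ri / re) n ^ 2) :
    HasEigenvector (T : Module.End ℂ (DensitySpace ri re))
      ((1 / (2 * (2 * n + 1)) * s : ℝ) : ℂ) (npPair ri re n s p) :=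
  ⟨mem_eigenspace_iff.2 (hT.apply_npPair hri hre hp hs),
    npPair_ne_zero hri (hri.trans hre) n s hp0⟩

theorem pairCoeff_eq_zero (hT : IsNPOperator ri re T) (hri : 0 < ri) (hre : ri < re) {z : ℂ}
    {φ : DensitySpace ri re} (hφ : T φ = z • φ) (hz : z ^ 2 ≠ (npEigenvalue (ri / re) n : ℂ) ^ 2)
    (hp : p ∈ harmonicSubmodule (Fin 3) ℂ n) : pairCoeff ri re p φ = 0 :=
  eq_zero_of_npMatrix_mulVec_eq_smul (div_pos hri (hri.trans hre)).le hz
    (hT.npMatrix_mulVec_pairCoeff hri hre hφ hp)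

theorem eigenspace_eq_span (hT : IsNPOperator ri re T) (hri : 0 < ri) (hre : ri < re)
    {Y : Set.Icc (-(n : ℤ)) n → MvPolynomial (Fin 3) ℂ} (hY : IsOrthonormalSphericalHarmonics n Y)
    {s : ℝ} (hs : s ^ 2 = npRoot (ri / re) n ^ 2) :
    eigenspace (T : Module.End ℂ (DensitySpace ri re)) ((1 / (2 * (2 * n + 1)) * s : ℝ) : ℂ)
      = Submodule.span ℂ (Set.range fun m => npPair ri re n s (Y m)) := by
  have hre0 := hri.trans hre
  have hρ := div_pos hri hre0
  refine le_antisymm (fun φ hφ => ?_) (Submodule.span_le.2 (Set.range_subset_iff.2 fun m =>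
    mem_eigenspace_iff.2 (hT.apply_npPair hri hre (hY.mem_harmonicSubmodule m) hs)))
  rw [mem_eigenspace_iff] at hφ
  have hother : ∀ k, k ≠ n → ∀ p ∈ harmonicSubmodule (Fin 3) ℂ k, pairCoeff ri re p φ = 0 := by
    intro k hk p hp
    refine hT.pairCoeff_eq_zero hri hre hφ (fun hz => hk ?_) hp
    refine (strictAnti_npEigenvalue_sq hρ.le ((div_lt_one hre0).2 hre)).injective ?_
    have hsq : (1 / (2 * (2 * n + 1)) * s) ^ 2 = npEigenvalue (ri / re) k ^ 2 := by
      exact_mod_cast hz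
    exact hsq.symm.trans (by rw [npEigenvalue, mul_pow, mul_pow, hs])
  rw [hY.eq_sum_harmonicPair hri hre0 hother]
  refine Submodule.sum_mem _ fun m _ => ?_
  obtain ⟨t, ht⟩ := exists_eq_smul_npVector hρ
    (hT.npMatrix_mulVec_pairCoeff hri hre hφ (hY.mem_harmonicSubmodule m))
  rw [ht, map_smul, ← npPair_eq_harmonicPair]
  exact Submodule.smul_mem _ t (Submodule.subset_span ⟨m, rfl⟩)

theorem hasEigenvalue_iff (hT : IsNPOperator ri re T) (hri : 0 < ri) (hre : ri < re) (z : ℂ) :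
    HasEigenvalue (T : Module.End ℂ (DensitySpace ri re)) z ↔
      ∃ n : ℕ, z = (npEigenvalue (ri / re) n : ℂ) ∨ z = -(npEigenvalue (ri / re) n : ℂ) := by
  have hre0 := hri.trans hre
  constructor
  · intro h
    obtain ⟨φ, hφ, hφ0⟩ := h.exists_hasEigenvector
    by_contra! hne
    refine hφ0 (eq_zero_of_pairCoeff_eq_zero hri hre0 fun n p hp =>
      hT.pairCoeff_eq_zero hri hre (mem_eigenspace_iff.1 hφ) (fun hz => ?_) hp)
    exact (sq_eq_sq_iff_eq_or_eq_neg.1 hz).elim (hne n).1 (hne n).2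
  · rintro ⟨n, hz⟩
    obtain ⟨p, hp, hp0⟩ := exists_mem_harmonicSubmodule_angularLp_ne_zero hre0 n
    rcases hz with rfl | rfl
    · exact hasEigenvalue_of_hasEigenvector (hT.hasEigenvector_npPair hri hre hp hp0 rfl)
    · rw [npEigenvalue, ← Complex.ofReal_neg, ← mul_neg]
      exact hasEigenvalue_of_hasEigenvector (hT.hasEigenvector_npPair hri hre hp hp0 (neg_sq _))

end IsNPOperator

end Spectrum

end

theorem proposition3p2 (ri re : ℝ) (hri : 0 < ri) (hre : ri < re) :
    (∀ (r₀ : ℝ), 0 < r₀ →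
      ∀ (n : ℕ) (Y : Set.Icc (-(n : ℤ)) n → MvPolynomial (Fin 3) ℂ),
        IsOrthonormalSphericalHarmonics n Y → ∀ m, ∀ x : E3, ‖x‖ = r₀ →
          neumannPoincareStar r₀ (angular (Y m)) x
            = 1 / (2 * (2 * (n : ℂ) + 1)) * angular (Y m) x) ∧
    ∃ T : DensitySpace ri re →L[ℂ] DensitySpace ri re, IsNPOperator ri re T ∧
      (∀ z : ℂ, HasEigenvalue (T : Module.End ℂ (DensitySpace ri re)) z ↔
        ∃ n : ℕ, z = (npEigenvalue (ri / re) n : ℂ) ∨ z = -(npEigenvalue (ri / re) n : ℂ)) ∧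
      ∀ (n : ℕ) (Y : Set.Icc (-(n : ℤ)) n → MvPolynomial (Fin 3) ℂ),
        IsOrthonormalSphericalHarmonics n Y →
          (∀ m, HasEigenvector (T : Module.End ℂ (DensitySpace ri re)) (npEigenvalue (ri / re) n : ℂ)
            (npPair ri re n (npRoot (ri / re) n) (Y m))) ∧
          (∀ m, HasEigenvector (T : Module.End ℂ (DensitySpace ri re)) (-(npEigenvalue (ri / re) n : ℂ))
            (npPair ri re n (-npRoot (ri / re) n) (Y m))) ∧
          eigenspace (T : Module.End ℂ (DensitySpace ri re)) (npEigenvalue (ri / re) n : ℂ)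
            = Submodule.span ℂ (Set.range fun m =>
                npPair ri re n (npRoot (ri / re) n) (Y m)) ∧
          eigenspace (T : Module.End ℂ (DensitySpace ri re)) (-(npEigenvalue (ri / re) n : ℂ))
            = Submodule.span ℂ (Set.range fun m =>
                npPair ri re n (-npRoot (ri / re) n) (Y m)) := by
  refine ⟨fun r₀ hr₀ n Y hY m x hx =>
    neumannPoincareStar_angular hr₀ (hY.mem_harmonicSubmodule m) hx, ?_⟩
  obtain ⟨T, hT⟩ := exists_isNPOperator hri hre
  refine ⟨T, hT, hT.hasEigenvalue_iff hri hre, fun n Y hY => ?_⟩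
  have hvec := fun m {s} => hT.hasEigenvector_npPair hri hre (s := s) (hY.mem_harmonicSubmodule m)
    (hY.angularLp_ne_zero (hri.trans hre) m)
  have hneg : -(npEigenvalue (ri / re) n : ℂ)
      = ((1 / (2 * (2 * n + 1)) * -npRoot (ri / re) n : ℝ) : ℂ) := by
    rw [mul_neg, Complex.ofReal_neg, npEigenvalue]
  rw [hneg]
  exact ⟨fun m => hvec m rfl, fun m => hvec m (neg_sq _), hT.eigenspace_eq_span hri hre hY rfl,
    hT.eigenspace_eq_span hri hre hY (neg_sq _)⟩
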